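/- Let $p\ge 3$ and $n\ge 1$ be integers, and let $X\sim N_p(\theta,\sigma^2 I_p)$ and $S\sim\sigma^2\chi^2_n$ be independent, with $\theta\in\mathbb{R}^p$ and $\sigma^2>0$ both unknown. Put $W=\|X\|^2/S$ and $c=\frac{p-2}{n+2}$. Consider the positive-part Stein estimator $$\delta_{JS}^+=\max\Bigl(0,\;1-\frac{c}{W}\Bigr)X,$$ its MSE matrix $M(\delta_{JS}^+)=\mathrm{E}[(\delta_{JS}^+-\theta)(\delta_{JS}^+-\theta)^{\top}]$ and its MSE $R(\delta_{JS}^+)=\operatorname{tr}M(\delta_{JS}^+)$; all these expectations are finite. Let $\Gamma=\Gamma(X)$ be an orthogonal matrix with $\Gamma X=(\|X\|,0,\dots,0)^{\top}$, let $E_{11}$ be the $p\times p$ matrix with $(1,1)$ entry $1$ and all other entries $0$, and let $$C_0=2\Bigl(\frac pn-\frac{p-2}{n+2}\Bigr)c^{-n/2},\qquad C_1=2\Bigl(\frac1n-\frac1{n+2}\Bigr)c^{-n/2},\qquad C_2=\frac{4}{n+2}\,c^{-n/2}.$$ Then $R(\delta_{JS}^+)$, as a function of the unknown $(\theta,\sigma^2)$,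 has a uniformly minimum variance unbiased estimator (UMVUE) based on $(X,S)$; it is almost surely unique under every $(\theta,\sigma^2)$, and it is $$\hat R_0(\delta_{JS}^+)=\begin{cases}-\dfrac{pS}{n}+SW+C_0\,S\,W^{n/2}, & W\le c,\\[2mm] \dfrac{pS}{n}-\Bigl(\dfrac{p-2}{n+2}\Bigr)^2\dfrac{S}{W}, & W>c.\end{cases}$$ Likewise $M(\delta_{JS}^+)$ has an almost surely unique UMVUE (an unbiased matrix estimator such that the variance of every linear combination of its entries is minimal among unbiased matrix estimators, for every $(\theta,\sigma^2)$), and for every choice of $\Gamma$ it is $$\hat M_0(\delta_{JS}^+)=\begin{cases}S\,\Gamma^{\top}\Bigl[\dfrac{I_p}{n}-\Bigl(\dfrac2n-C_1W^{n/2}\Bigr)I_p+\bigl(W+C_2W^{n/2}\bigr)E_{11}\Bigr]\Gamma, & W\le c,\\[3mm] S\,\Gamma^{\top}\Bigl[\dfrac{I_p}{n}-\dfrac{p-2}{(n+2)^2}\dfrac1W\bigl(2I_p-(p+2)E_{11}\bigr)\Bigr]\Gamma, & W>c.\end{cases}$$ The expressions for $W>c$ are the James–Stein formulas. -/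

import Mathlib

open MeasureTheory ProbabilityTheory

noncomputable section

namespace SteinMSE

/-! ### Uniformly minimum variance unbiased estimation -/

section UMVUE

variable {Ω Θ ι : Type*} [MeasurableSpace Ω]

/-- `T` is an unbiased estimator of the real parametric function `τ` in the statistical
model `P`: a measurable function of the data with a finite expectation `τ η` under every
parameter `η`. -/
def IsUnbiased (P : Θ → Measure Ω) (τ : Θ → ℝ) (T : Ω → ℝ) : Prop :=
  Measurable T ∧ ∀ η, Integrable T (P η) ∧ ∫ ω, T ω ∂(P η) = τ η

/-- `T` is a uniformly minimum variance unbiased estimator of `τ`: it is unbiased, has finite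
variance, and under every parameter its variance is at most that of any unbiased estimator
(whose variance is allowed to be infinite). -/
def IsUMVUE (P : Θ → Measure Ω) (τ : Θ → ℝ) (T : Ω → ℝ) : Prop :=
  IsUnbiased P τ T ∧ (∀ η, MemLp T 2 (P η)) ∧
    ∀ U, IsUnbiased P τ U → ∀ η, evariance T (P η) ≤ evariance U (P η)

/-- Unbiased estimators of a matrix-valued parametric function. -/
def IsMatrixUnbiased (P : Θ → Measure Ω) (τ : Θ → Matrix ι ι ℝ) (T : Ω → Matrix ι ι ℝ) : Prop :=
  ∀ i j, IsUnbiased P (fun η => τ η i j) (fun ω => T ω i j)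

/-- Uniformly minimum variance unbiased estimators of a matrix-valued parametric function.
Minimality of the covariance matrix of the entries is in the Loewner order, that is, for every
linear combination `∑ i j, A i j * T i j` of the entries (in particular for every entry). -/
def IsMatrixUMVUE [Fintype ι] (P : Θ → Measure Ω) (τ : Θ → Matrix ι ι ℝ)
    (T : Ω → Matrix ι ι ℝ) : Prop :=
  IsMatrixUnbiased P τ T ∧ (∀ η i j, MemLp (fun ω => T ω i j) 2 (P η)) ∧
    ∀ U, IsMatrixUnbiased P τ U → ∀ (A : Matrix ι ι ℝ) η,
      evariance (fun ω => ∑ i, ∑ j, A i j * T ω i j) (P η) ≤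
        evariance (fun ω => ∑ i, ∑ j, A i j * U ω i j) (P η)

end UMVUE

/-! ### The normal model and the estimators -/

/-- The data `(X, S)`. -/
abbrev Data (p : ℕ) : Type := EuclideanSpace ℝ (Fin p) × ℝ

/-- The parameters `(θ, σ²)`, with `σ² > 0`. -/
abbrev Param (p : ℕ) : Type := EuclideanSpace ℝ (Fin p) × Set.Ioi (0 : ℝ)

/-- The chi-square distribution with `n` degrees of freedom. -/
def chiSquare (n : ℕ) : Measure ℝ := gammaMeasure ((n : ℝ) / 2) (1 / 2)

/-- The joint law of independent `X ∼ N_p(θ, σ² I)` and `S ∼ σ² χ²_n`. -/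
def model (p n : ℕ) (η : Param p) : Measure (Data p) :=
  (multivariateGaussian η.1 ((η.2 : ℝ) • (1 : Matrix (Fin p) (Fin p) ℝ))).prod
    ((chiSquare n).map fun s => (η.2 : ℝ) * s)

/-- `W = ‖X‖² / S`. -/
def statW {p : ℕ} (ω : Data p) : ℝ := ‖ω.1‖ ^ 2 / ω.2

/-- The constant `(p - 2) / (n + 2)`. -/
def cut (p n : ℕ) : ℝ := ((p : ℝ) - 2) / ((n : ℝ) + 2)

/-- The positive-part Stein estimator `max (0, 1 - ((p - 2) / (n + 2)) (1 / W)) X`. -/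
def positivePart (p n : ℕ) (ω : Data p) : EuclideanSpace ℝ (Fin p) :=
  max 0 (1 - cut p n * (1 / statW ω)) • ω.1

/-- The MSE matrix `E[(δ - θ)(δ - θ)ᵀ]` of an estimator `δ` of `θ`. -/
def mseMatrix {p : ℕ} (n : ℕ) (δ : Data p → EuclideanSpace ℝ (Fin p)) (η : Param p) :
    Matrix (Fin p) (Fin p) ℝ :=
  Matrix.of fun i j => ∫ ω, (δ ω i - η.1 i) * (δ ω j - η.1 j) ∂(model p n η)

/-- The MSE of an estimator of `θ`, the trace of its MSE matrix. -/
def mse {p : ℕ} (n : ℕ) (δ : Data p → EuclideanSpace ℝ (Fin p)) (η : Param p) : ℝ :=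
  (mseMatrix n δ η).trace

/-! ### The formulas -/

def C₀ (p n : ℕ) : ℝ := 2 * ((p : ℝ) / n - cut p n) * cut p n ^ (-(n : ℝ) / 2)

def C₁ (p n : ℕ) : ℝ := 2 * (1 / (n : ℝ) - 1 / ((n : ℝ) + 2)) * cut p n ^ (-(n : ℝ) / 2)

def C₂ (p n : ℕ) : ℝ := 4 / ((n : ℝ) + 2) * cut p n ^ (-(n : ℝ) / 2)

/-- `E₁₁`: one in the first diagonal position and zero elsewhere. -/
def E₁₁ (p : ℕ) : Matrix (Fin p) (Fin p) ℝ :=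
  Matrix.of fun i j => if i.val = 0 ∧ j.val = 0 then 1 else 0

/-- `G` is an orthogonal matrix with `G x = (‖x‖, 0, …, 0)ᵀ`. -/
def IsAligning {p : ℕ} (G : Matrix (Fin p) (Fin p) ℝ) (x : EuclideanSpace ℝ (Fin p)) : Prop :=
  G ∈ Matrix.orthogonalGroup (Fin p) ℝ ∧
    G.mulVec x.ofLp = fun i => if i.val = 0 then ‖x‖ else 0

/-- The James–Stein formula for the estimated MSE. -/
def mseJS (p n : ℕ) (ω : Data p) : ℝ :=
  (p : ℝ) * ω.2 / n - cut p n ^ 2 * (ω.2 / statW ω)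

/-- The James–Stein formula for the estimated MSE matrix. -/
def mseMatrixJS (p n : ℕ) (Γ : EuclideanSpace ℝ (Fin p) → Matrix (Fin p) (Fin p) ℝ)
    (ω : Data p) : Matrix (Fin p) (Fin p) ℝ :=
  ω.2 • ((Γ ω.1).transpose *
    ((1 / (n : ℝ)) • (1 : Matrix (Fin p) (Fin p) ℝ) -
      (((p : ℝ) - 2) / ((n : ℝ) + 2) ^ 2 * (1 / statW ω)) •
        ((2 : ℝ) • (1 : Matrix (Fin p) (Fin p) ℝ) - ((p : ℝ) + 2) • E₁₁ p)) * Γ ω.1)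

open Classical in
/-- The formula for the estimated MSE of the positive-part Stein estimator. -/
def msePositive (p n : ℕ) (ω : Data p) : ℝ :=
  if statW ω ≤ cut p n then
    -((p : ℝ) * ω.2 / n) + ω.2 * statW ω + C₀ p n * ω.2 * statW ω ^ ((n : ℝ) / 2)
  else mseJS p n ω

open Classical in
/-- The formula for the estimated MSE matrix of the positive-part Stein estimator. -/
def mseMatrixPositive (p n : ℕ) (Γ : EuclideanSpace ℝ (Fin p) → Matrix (Fin p) (Fin p) ℝ)
    (ω : Data p) : Matrix (Fin p) (Fin p) ℝ :=
  if statW ω ≤ cut p n then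
    ω.2 • ((Γ ω.1).transpose *
      ((1 / (n : ℝ)) • (1 : Matrix (Fin p) (Fin p) ℝ) -
        (2 / (n : ℝ) - C₁ p n * statW ω ^ ((n : ℝ) / 2)) • (1 : Matrix (Fin p) (Fin p) ℝ) +
        (statW ω + C₂ p n * statW ω ^ ((n : ℝ) / 2)) • E₁₁ p) * Γ ω.1)
  else mseMatrixJS p n Γ ω

end SteinMSE

end

/-! The model is an exponential family with canonical statistic `(x, ‖x‖² + s)`, whose natural
parameter ranges over an open set. Since this statistic is a homeomorphic image of the data, the
data themselves are complete: an unbiased estimator of zero has vanishing integral against every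
small exponential tilt, so uniqueness of Laplace transforms forces it to be zero
(`isCompleteModel_model`). Hence any two unbiased estimators of the same quantity agree almost
surely, and it suffices to show that the stated formulas are unbiased and square integrable.

Write `r = ‖X‖²`, `d = c S` and `δ⁺ = X + g` with `gᵢ = -(d / max d r) Xᵢ`. An entry of the MSE
matrix is `σ² 1_{i=j}`, plus two cross terms such as `E[(X - θ)ⱼ gᵢ]`, plus `E[gᵢ gⱼ]`. The first is
estimated by `S / n`, and the last integrand is already a function of the data. Stein's identity
turns the cross term into `σ² E[∂ⱼ gᵢ]`, where `g` is continuous with a kink on the sphere `r = d`.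

The unknown factor `σ²` is absorbed by a second integration by parts, now in `S`. Given `k(s) = ∂ⱼ
gᵢ`, one seeks `K` with `(s^{n/2-1} K)' = s^{n/2-1} k / 2`; then `E[K(S)] = σ² E[k(S)]`. The kernel
`k` changes form at `s = r / c`. Below that point `K` is the James–Stein term. Above it, continuity
forces a multiple of the homogeneous solution `s^{1-n/2}`, and this is the origin of the terms `S
W^{n/2}` and of the constants `C₀`, `C₁`, `C₂`. -/

noncomputable section

namespace SteinMSE


/-! ### Lehmann–Scheffé for complete models -/

section Completeness

variable {Ω Θ ι : Type*} [MeasurableSpace Ω]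

/-- A statistical model is complete if the only unbiased estimator of zero is zero. -/
def IsCompleteModel (P : Θ → Measure Ω) : Prop :=
  ∀ f : Ω → ℝ, IsUnbiased P (fun _ => 0) f → ∀ η, f =ᵐ[P η] 0

theorem IsCompleteModel.ae_eq {P : Θ → Measure Ω} (hP : IsCompleteModel P) {τ : Θ → ℝ}
    {T U : Ω → ℝ} (hT : IsUnbiased P τ T) (hU : IsUnbiased P τ U) (η : Θ) : T =ᵐ[P η] U := by
  have h : IsUnbiased P (fun _ => 0) (fun ω => T ω - U ω) := by
    refine ⟨hT.1.sub hU.1, fun η => ⟨(hT.2 η).1.sub (hU.2 η).1, ?_⟩⟩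
    rw [integral_sub (hT.2 η).1 (hU.2 η).1, (hT.2 η).2, (hU.2 η).2, sub_self]
  filter_upwards [hP _ h η] with ω hω
  exact sub_eq_zero.mp hω

/-- No Rao–Blackwell step is needed: the whole data set is complete, so every unbiased competitor
equals `T` almost surely and the variances tie. -/
theorem IsCompleteModel.isUMVUE {P : Θ → Measure Ω} (hP : IsCompleteModel P) {τ : Θ → ℝ}
    {T : Ω → ℝ} (hT : IsUnbiased P τ T) (hT2 : ∀ η, MemLp T 2 (P η)) : IsUMVUE P τ T :=
  ⟨hT, hT2, fun _ hU η => (evariance_congr (hP.ae_eq hT hU η)).le⟩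

theorem IsCompleteModel.isMatrixUMVUE [Fintype ι] {P : Θ → Measure Ω} (hP : IsCompleteModel P)
    {τ : Θ → Matrix ι ι ℝ} {T : Ω → Matrix ι ι ℝ} (hT : IsMatrixUnbiased P τ T)
    (hT2 : ∀ η i j, MemLp (fun ω => T ω i j) 2 (P η)) : IsMatrixUMVUE P τ T := by
  refine ⟨hT, hT2, fun U hU A η => (evariance_congr ?_).le⟩
  have h : ∀ᵐ ω ∂(P η), ∀ i j, T ω i j = U ω i j :=
    ae_all_iff.mpr fun i => ae_all_iff.mpr fun j => hP.ae_eq (hT i j) (hU i j) η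
  filter_upwards [h] with ω hω
  simp only [hω]

theorem IsCompleteModel.matrix_ae_eq [Fintype ι] {P : Θ → Measure Ω} (hP : IsCompleteModel P)
    {τ : Θ → Matrix ι ι ℝ} {T U : Ω → Matrix ι ι ℝ} (hT : IsMatrixUnbiased P τ T)
    (hU : IsMatrixUnbiased P τ U) (η : Θ) : T =ᵐ[P η] U := by
  have h : ∀ᵐ ω ∂(P η), ∀ i j, T ω i j = U ω i j :=
    ae_all_iff.mpr fun i => ae_all_iff.mpr fun j => hP.ae_eq (hT i j) (hU i j) η
  filter_upwards [h] with ω hω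
  ext i j
  exact hω i j

end Completeness

/-! ### Uniqueness of Laplace transforms -/

section Laplace

open Filter Topology

/-- Two finite measures whose moment generating functions are finite and agree near zero have
the same characteristic function. -/
theorem charFun_map_eq_of_mgf_eventuallyEq {Ω : Type*} [MeasurableSpace Ω] {μ ν : Measure Ω}
    {X : Ω → ℝ} (hX : Measurable X)
    (hμ : ∀ᶠ t in 𝓝 (0 : ℝ), Integrable (fun ω => Real.exp (t * X ω)) μ)
    (hν : ∀ᶠ t in 𝓝 (0 : ℝ), Integrable (fun ω => Real.exp (t * X ω)) ν)
    (h : ∀ᶠ t in 𝓝 (0 : ℝ), mgf X μ t = mgf X ν t) (t : ℝ) :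
    charFun (μ.map X) t = charFun (ν.map X) t := by
  rw [← complexMGF_mul_I hX.aemeasurable, ← complexMGF_mul_I hX.aemeasurable]
  -- Both complex moment generating functions are analytic on the vertical strip over `I`. They
  -- agree at real points accumulating at 0, so the identity theorem carries the equality to the
  -- imaginary axis.
  set I : Set ℝ := interior (integrableExpSet X μ) ∩ interior (integrableExpSet X ν) with hI
  have h0 : (0 : ℝ) ∈ I :=
    ⟨mem_interior_iff_mem_nhds.mpr hμ, mem_interior_iff_mem_nhds.mpr hν⟩
  have hconv : Convex ℝ I := convex_integrableExpSet.interior.inter convex_integrableExpSet.interior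
  have hpre : IsPreconnected {z : ℂ | z.re ∈ I} :=
    (hconv.linear_preimage Complex.reLm).isPreconnected
  have hA : AnalyticOnNhd ℂ (complexMGF X μ) {z : ℂ | z.re ∈ I} :=
    analyticOnNhd_complexMGF.mono fun z hz => hz.1
  have hB : AnalyticOnNhd ℂ (complexMGF X ν) {z : ℂ | z.re ∈ I} :=
    analyticOnNhd_complexMGF.mono fun z hz => hz.2
  have hfreq : ∃ᶠ z in 𝓝[≠] (0 : ℂ), complexMGF X μ z = complexMGF X ν z := by
    have h1 : Filter.Frequently (fun t : ℝ => complexMGF X μ (t : ℂ) = complexMGF X ν (t : ℂ))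
        (𝓝[≠] (0 : ℝ)) := by
      refine Filter.Eventually.frequently ?_
      filter_upwards [h.filter_mono nhdsWithin_le_nhds] with t ht
      rw [complexMGF_ofReal, complexMGF_ofReal, ht]
    refine Filter.Tendsto.frequently (f := fun t : ℝ => (t : ℂ)) ?_ h1
    refine tendsto_nhdsWithin_iff.mpr ⟨?_, ?_⟩
    · have : Tendsto (fun t : ℝ => (t : ℂ)) (𝓝 0) (𝓝 ((0 : ℝ) : ℂ)) :=
        Complex.continuous_ofReal.tendsto 0
      simpa using this.mono_left nhdsWithin_le_nhds
    · filter_upwards [self_mem_nhdsWithin] with t ht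
      simpa using ht
  exact hA.eqOn_of_preconnected_of_frequently_eq hB hpre (z₀ := 0) (by simpa using h0) hfreq
    (by simpa using h0)

/-- A function whose integral against all small exponential tilts of a finite measure vanishes
is zero almost everywhere. -/
theorem ae_eq_zero_of_integral_mul_exp_eq_zero {Ω F : Type*} [MeasurableSpace Ω]
    [NormedAddCommGroup F] [NormedSpace ℝ F] [CompleteSpace F] [MeasurableSpace F] [BorelSpace F]
    [SecondCountableTopology F] {P : Measure Ω} (e : Ω ≃ᵐ F) {f : Ω → ℝ}
    (hf : Measurable f)
    (h : ∀ L : StrongDual ℝ F, ∀ᶠ t in 𝓝 (0 : ℝ),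
      Integrable (fun ω => f ω * Real.exp (t * L (e ω))) P ∧
        ∫ ω, f ω * Real.exp (t * L (e ω)) ∂P = 0) :
    f =ᵐ[P] 0 := by
  have hint : Integrable f P := by
    simpa using (h 0).self_of_nhds.1
  -- `ENNReal.ofReal` clips negative values, so `μ f` and `μ (-f)` are the positive and negative
  -- parts of the signed measure `f P`. The claim is that they coincide.
  set μ : (Ω → ℝ) → Measure Ω := fun g => P.withDensity fun ω => ENNReal.ofReal (g ω) with hμ
  have hfin : ∀ g : Ω → ℝ, Integrable g P → IsFiniteMeasure (μ g) := fun g hg =>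
    isFiniteMeasure_withDensity_ofReal hg.2
  have := hfin f hint
  have := hfin (fun ω => -f ω) hint.neg
  have hi : ∀ g : Ω → ℝ, Measurable g → ∀ h : Ω → ℝ, Measurable h →
      Integrable (fun ω => g ω * h ω) P → Integrable h (μ g) := by
    intro g hg h hh hgh
    rw [hμ, integrable_withDensity_iff (by fun_prop) (by simp)]
    refine hgh.mono (by fun_prop) (ae_of_all _ fun ω => ?_)
    rw [norm_mul, norm_mul, mul_comm]
    gcongr
    rw [Real.norm_eq_abs, Real.norm_eq_abs, ENNReal.toReal_ofReal', abs_of_nonneg (by positivity)]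
    exact max_le (le_abs_self _) (abs_nonneg _)
  have hv : ∀ g : Ω → ℝ, Measurable g → ∀ h : Ω → ℝ,
      ∫ ω, h ω ∂(μ g) = ∫ ω, max (g ω) 0 * h ω ∂P := by
    intro g hg h
    rw [hμ, integral_withDensity_eq_integral_toReal_smul (by fun_prop) (by simp)]
    simp [ENNReal.toReal_ofReal']
  have key : (μ f).map e = (μ fun ω => -f ω).map e := by
    refine Measure.ext_of_charFunDual (funext fun L => ?_)
    rw [charFunDual_eq_charFun_map_one, charFunDual_eq_charFun_map_one,
      Measure.map_map (by fun_prop) e.measurable, Measure.map_map (by fun_prop) e.measurable]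
    have hm : Measurable (L ∘ e) := by fun_prop
    -- Each `L` is treated separately, through the one-dimensional projection `L ∘ e` at frequency
    -- 1. This is why the neighbourhood of `t` in the hypothesis may depend on `L`.
    refine charFun_map_eq_of_mgf_eventuallyEq hm ?_ ?_ ?_ 1
    · filter_upwards [h L] with t ht
      exact hi f hf _ (by fun_prop) ht.1
    · filter_upwards [h L] with t ht
      refine hi _ hf.neg _ (by fun_prop) ?_
      simpa using ht.1.neg
    · filter_upwards [h L] with t ht
      have h1 : Integrable (fun ω => max (f ω) 0 * Real.exp (t * (L ∘ e) ω)) P := by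
        refine ht.1.mono (by fun_prop) (ae_of_all _ fun ω => ?_)
        rw [norm_mul, norm_mul]
        gcongr ?_ * ‖_‖
        rw [Real.norm_eq_abs, Real.norm_eq_abs, abs_of_nonneg (by positivity)]
        exact max_le (le_abs_self _) (abs_nonneg _)
      have h2 : Integrable (fun ω => max (-f ω) 0 * Real.exp (t * (L ∘ e) ω)) P := by
        refine ht.1.mono (by fun_prop) (ae_of_all _ fun ω => ?_)
        rw [norm_mul, norm_mul]
        gcongr ?_ * ‖_‖
        rw [Real.norm_eq_abs, Real.norm_eq_abs, abs_of_nonneg (by positivity)]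
        exact max_le (neg_le_abs _) (abs_nonneg _)
      rw [mgf, mgf, hv f hf, hv (fun ω => -f ω) hf.neg, ← sub_eq_zero, ← integral_sub h1 h2]
      refine (integral_congr_ae (ae_of_all _ fun ω => ?_)).trans ht.2
      simp only [Function.comp]
      rw [← sub_mul]
      congr 1
      rcases le_total (f ω) 0 with h0 | h0
      · rw [max_eq_right h0, max_eq_left (by linarith)]; ring
      · rw [max_eq_left h0, max_eq_right (by linarith)]; ring
  have key2 : μ f = μ fun ω => -f ω := by
    have := congrArg (Measure.map e.symm) key
    simpa [Measure.map_map e.symm.measurable e.measurable] using this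
  have key3 : (fun ω => ENNReal.ofReal (f ω)) =ᵐ[P] fun ω => ENNReal.ofReal (-f ω) := by
    refine (withDensity_eq_iff (by fun_prop) (by fun_prop) ?_).mp key2
    exact hint.lintegral_lt_top.ne
  filter_upwards [key3] with ω hω
  rcases lt_trichotomy (f ω) 0 with h0 | h0 | h0
  · rw [ENNReal.ofReal_of_nonpos h0.le, eq_comm, ENNReal.ofReal_eq_zero] at hω
    linarith
  · exact h0
  · rw [ENNReal.ofReal_of_nonpos (by linarith : -f ω ≤ 0), ENNReal.ofReal_eq_zero] at hω
    linarith

end Laplace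


/-! ### Exponential tilts of Gaussian and gamma laws -/

section Densities

theorem pi_withDensity_ofReal {ι : Type*} [Fintype ι] {α : ι → Type*}
    [∀ i, MeasurableSpace (α i)] (μ : ∀ i, Measure (α i)) [∀ i, SigmaFinite (μ i)]
    {f : ∀ i, α i → ℝ} (hf : ∀ i x, 0 ≤ f i x) (hfi : ∀ i, Integrable (f i) (μ i)) :
    Measure.pi (fun i => (μ i).withDensity fun x => ENNReal.ofReal (f i x)) =
      (Measure.pi μ).withDensity fun x => ENNReal.ofReal (∏ i, f i (x i)) := by
  have hfin : ∀ i, IsFiniteMeasure ((μ i).withDensity fun x => ENNReal.ofReal (f i x)) :=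
    fun i => isFiniteMeasure_withDensity_ofReal (hfi i).2
  refine Measure.pi_eq (μ := fun i => (μ i).withDensity fun x => ENNReal.ofReal (f i x))
    fun s hs => ?_
  have hS : MeasurableSet (Set.univ.pi s) := MeasurableSet.univ_pi hs
  rw [withDensity_apply _ hS, ← lintegral_indicator hS]
  have h1 : (Set.univ.pi s).indicator (fun x => ENNReal.ofReal (∏ i, f i (x i))) =
      fun x => ENNReal.ofReal (∏ i, (s i).indicator (f i) (x i)) := by
    funext x
    by_cases hx : x ∈ Set.univ.pi s
    · rw [Set.indicator_of_mem hx]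
      congr 1
      refine Finset.prod_congr rfl fun i _ => ?_
      rw [Set.indicator_of_mem (hx i (Set.mem_univ i))]
    · rw [Set.indicator_of_notMem hx]
      obtain ⟨i, hi⟩ : ∃ i, x i ∉ s i := by simpa [Set.mem_pi] using hx
      rw [Finset.prod_eq_zero (Finset.mem_univ i) (Set.indicator_of_notMem hi _)]
      simp
  have h2 : ∀ i, Integrable ((s i).indicator (f i)) (μ i) := fun i => (hfi i).indicator (hs i)
  rw [h1, ← ofReal_integral_eq_lintegral_ofReal (Integrable.fintype_prod_dep h2)
    (ae_of_all _ fun x => Finset.prod_nonneg fun i _ => Set.indicator_nonneg (fun y _ => hf i y) _),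
    integral_fintype_prod_eq_prod, ENNReal.ofReal_prod_of_nonneg
      (fun i _ => integral_nonneg fun y => Set.indicator_nonneg (fun y _ => hf i y) _)]
  refine Finset.prod_congr rfl fun i _ => ?_
  rw [withDensity_apply _ (hs i), integral_indicator (hs i),
    ofReal_integral_eq_lintegral_ofReal (hfi i).integrableOn (ae_of_all _ fun y => hf i y)]

open scoped NNReal

/-- The two equations say that the tilt shifts the natural parameters `m / v` and `-1 / (2 v)` by
`a` and `w`. The normalising constant is the ratio of the densities at 0, where the tilt equals 1.
-/
theorem gaussianReal_eq_withDensity_exp {m₀ m a w : ℝ} {v₀ v : ℝ≥0} (hv₀ : v₀ ≠ 0) (hv : v ≠ 0)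
    (h₁ : m / v = m₀ / v₀ + a) (h₂ : 1 / (2 * v : ℝ) = 1 / (2 * v₀) - w) :
    ∃ C : ℝ, 0 < C ∧ gaussianReal m v = (gaussianReal m₀ v₀).withDensity
      fun x => ENNReal.ofReal (C * Real.exp (a * x + w * x ^ 2)) := by
  refine ⟨gaussianPDFReal m v 0 / gaussianPDFReal m₀ v₀ 0,
    div_pos (gaussianPDFReal_pos _ _ _ hv) (gaussianPDFReal_pos _ _ _ hv₀), ?_⟩
  have hv' : (v : ℝ) ≠ 0 := by simpa using hv
  have hv₀' : (v₀ : ℝ) ≠ 0 := by simpa using hv₀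
  have hp : (0 : ℝ) < v := by positivity
  have hp₀ : (0 : ℝ) < v₀ := by positivity
  rw [gaussianReal_of_var_ne_zero _ hv, gaussianReal_of_var_ne_zero _ hv₀,
    ← withDensity_mul _ (measurable_gaussianPDF _ _) (by fun_prop)]
  congr 1
  funext x
  rw [Pi.mul_apply, gaussianPDF, gaussianPDF,
    ← ENNReal.ofReal_mul (gaussianPDFReal_nonneg _ _ _)]
  congr 1
  have key : -(x - m) ^ 2 / (2 * v) =
      -(x - m₀) ^ 2 / (2 * v₀) + (-(0 - m) ^ 2 / (2 * v) - -(0 - m₀) ^ 2 / (2 * v₀) +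
        (a * x + w * x ^ 2)) := by
    have e1 : -(x - m) ^ 2 / (2 * v) = -(x ^ 2 * (1 / (2 * v))) + x * (m / v) +
      -(0 - m) ^ 2 / (2 * v) := by field_simp; ring
    have e2 : -(x - m₀) ^ 2 / (2 * v₀) = -(x ^ 2 * (1 / (2 * v₀))) + x * (m₀ / v₀) +
      -(0 - m₀) ^ 2 / (2 * v₀) := by field_simp; ring
    rw [e1, e2, h₁, h₂]
    ring
  have hs : √(2 * Real.pi * v) ≠ 0 := by positivity
  have hs₀ : √(2 * Real.pi * v₀) ≠ 0 := by positivity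
  simp only [gaussianPDFReal]
  rw [key, Real.exp_add, Real.exp_add, Real.exp_sub]
  field_simp

theorem gammaMeasure_eq_withDensity_exp {a b₀ b w : ℝ} (ha : 0 < a) (hb₀ : 0 < b₀) (hb : 0 < b)
    (h : b = b₀ - w) :
    ∃ C : ℝ, 0 < C ∧ gammaMeasure a b = (gammaMeasure a b₀).withDensity
      fun x => ENNReal.ofReal (C * Real.exp (w * x)) := by
  refine ⟨b ^ a / b₀ ^ a, by positivity, ?_⟩
  have hm : ∀ r, Measurable (gammaPDF a r) := fun r =>
    (measurable_gammaPDFReal a r).ennreal_ofReal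
  rw [gammaMeasure, gammaMeasure, ← withDensity_mul _ (hm _) (by fun_prop)]
  congr 1
  funext x
  rw [Pi.mul_apply, gammaPDF, gammaPDF, ← ENNReal.ofReal_mul (gammaPDFReal_nonneg ha hb₀ _)]
  congr 1
  simp only [gammaPDFReal]
  split_ifs with hx
  · have : Real.exp (-(b * x)) = Real.exp (-(b₀ * x)) * Real.exp (w * x) := by
      rw [← Real.exp_add, h]; ring_nf
    rw [this]
    have : b₀ ^ a ≠ 0 := (Real.rpow_pos_of_pos hb₀ a).ne'
    field_simp
  · simp

theorem gammaMeasure_map_const_mul {a b v : ℝ} (hb : 0 < b) (hv : 0 < v) :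
    (gammaMeasure a b).map (fun s => v * s) = gammaMeasure a (b / v) := by
  have hm : ∀ r, Measurable (gammaPDF a r) := fun r =>
    (measurable_gammaPDFReal a r).ennreal_ofReal
  ext s hs
  rw [Measure.map_apply (by fun_prop) hs, gammaMeasure, gammaMeasure,
    withDensity_apply _ hs, withDensity_apply _ (hs.preimage (by fun_prop))]
  have h1 : (volume : Measure ℝ) =
      ENNReal.ofReal v • Measure.map (fun s => v * s) volume := by
    rw [Real.map_volume_mul_left hv.ne', smul_smul, abs_of_pos (by positivity),
      ← ENNReal.ofReal_mul (by positivity), mul_inv_cancel₀ hv.ne', ENNReal.ofReal_one, one_smul]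
  conv_rhs => rw [h1]
  rw [Measure.restrict_smul, lintegral_smul_measure, setLIntegral_map hs (hm _) (by fun_prop),
    smul_eq_mul, ← lintegral_const_mul' _ _ ENNReal.ofReal_ne_top]
  refine lintegral_congr fun x => ?_
  rw [gammaPDF, gammaPDF, ← ENNReal.ofReal_mul (by positivity)]
  congr 1
  simp only [gammaPDFReal, mul_nonneg_iff_of_pos_left hv]
  split_ifs with hx
  · rw [Real.div_rpow hb.le hv.le, Real.mul_rpow hv.le hx, Real.rpow_sub_one hv.ne']
    have : v ^ a ≠ 0 := (Real.rpow_pos_of_pos hv a).ne'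
    have e : b / v * (v * x) = b * x := by field_simp
    rw [e]
    field_simp
  · simp

/-- Comparing characteristic functions reduces the vector law to independent coordinates, where the
one-dimensional results apply. -/
theorem multivariateGaussian_smul_one {p : ℕ} (θ : EuclideanSpace ℝ (Fin p)) {v : ℝ}
    (hv : 0 ≤ v) :
    multivariateGaussian θ (v • (1 : Matrix (Fin p) (Fin p) ℝ)) =
      (Measure.pi fun i => gaussianReal (θ i) v.toNNReal).map (WithLp.toLp 2) := by
  apply Measure.ext_of_charFun (E := EuclideanSpace ℝ (Fin p))
  ext t
  have hS : (v • (1 : Matrix (Fin p) (Fin p) ℝ)).PosSemidef := Matrix.PosSemidef.one.smul hv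
  rw [charFun_multivariateGaussian hS, charFun_pi]
  simp_rw [charFun_gaussianReal, ← Complex.exp_sum]
  congr 1
  rw [Finset.sum_sub_distrib, PiLp.inner_apply]
  simp only [Matrix.smul_mulVec, Matrix.one_mulVec, dotProduct, Pi.smul_apply, smul_eq_mul,
    Real.coe_toNNReal _ hv]
  push_cast
  rw [Finset.sum_mul, Finset.sum_div]
  congr 1
  · refine Finset.sum_congr rfl fun i _ => ?_
    simp [mul_comm]
  · refine Finset.sum_congr rfl fun i _ => ?_
    ring

theorem model_eq {p n : ℕ} (η : Param p) :
    model p n η = ((Measure.pi fun i => gaussianReal (η.1 i) (η.2 : ℝ).toNNReal).map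
      (WithLp.toLp 2)).prod (gammaMeasure ((n : ℝ) / 2) (1 / 2 / (η.2 : ℝ))) := by
  have hv : (0 : ℝ) < η.2 := η.2.2
  rw [model, multivariateGaussian_smul_one _ hv.le, chiSquare,
    gammaMeasure_map_const_mul (by norm_num) hv]

end Densities


/-! ### Completeness of the normal model -/

section ModelCompleteness

open Filter Topology

theorem map_withDensity_comp {α β : Type*} [MeasurableSpace α] [MeasurableSpace β]
    (μ : Measure α) {e : α → β} (he : Measurable e) {f : β → ENNReal} (hf : Measurable f) :
    (μ.withDensity (f ∘ e)).map e = (μ.map e).withDensity f := by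
  ext s hs
  rw [Measure.map_apply he hs, withDensity_apply _ hs, withDensity_apply _ (he hs),
    setLIntegral_map hs hf he]
  rfl

instance {p n : ℕ} [NeZero n] (η : Param p) : IsProbabilityMeasure (model p n η) := by
  have hv : (0 : ℝ) < η.2 := η.2.2
  have hn : (0 : ℝ) < n := by exact_mod_cast Nat.pos_of_ne_zero (NeZero.ne n)
  have : IsProbabilityMeasure (gammaMeasure ((n : ℝ) / 2) (1 / 2 / (η.2 : ℝ))) :=
    isProbabilityMeasure_gammaMeasure (by positivity) (by positivity)
  have : IsProbabilityMeasure ((Measure.pi fun i => gaussianReal (η.1 i) (η.2 : ℝ).toNNReal).map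
      (WithLp.toLp 2)) := Measure.isProbabilityMeasure_map (by fun_prop)
  rw [model_eq]
  infer_instance

/-- The canonical statistic `(x, s) ↦ (x, ‖x‖² + s)` of the model, as a homeomorphism. -/
def canonicalStatistic (p : ℕ) : Data p ≃ₜ Data p where
  toFun ω := (ω.1, ‖ω.1‖ ^ 2 + ω.2)
  invFun ω := (ω.1, ω.2 - ‖ω.1‖ ^ 2)
  left_inv ω := by simp
  right_inv ω := by simp
  continuous_toFun := by fun_prop
  continuous_invFun := by fun_prop

theorem dual_data_apply {p : ℕ} (L : StrongDual ℝ (Data p)) (x : EuclideanSpace ℝ (Fin p))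
    (r : ℝ) : L (x, r) = ∑ i, L (EuclideanSpace.single i 1, 0) * x i + L (0, 1) * r := by
  have h1 : (x, r) = ∑ i, x i • ((EuclideanSpace.single i 1, 0) : Data p) +
      r • ((0, 1) : Data p) := by
    have : x = ∑ i, x i • (EuclideanSpace.single i 1 : EuclideanSpace ℝ (Fin p)) := by
      ext j
      simp [Finset.sum_apply, Pi.single_apply]
    refine Prod.ext ?_ ?_
    · simpa [Prod.fst_sum] using this
    · simp [Prod.snd_sum]
  conv_lhs => rw [h1]
  rw [map_add, map_sum]
  simp only [map_smul, smul_eq_mul, mul_comm]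

/-- Exponential tilts along the canonical statistic stay in the model. -/
theorem exists_model_eq_withDensity_exp {p n : ℕ} (hn : 1 ≤ n) (η₀ : Param p)
    (L : StrongDual ℝ (Data p)) {t : ℝ} (ht : t * L (0, 1) < 1 / (2 * (η₀.2 : ℝ))) :
    ∃ (η : Param p) (C : ℝ), 0 < C ∧ model p n η = (model p n η₀).withDensity
      fun ω => ENNReal.ofReal (C * Real.exp (t * L (canonicalStatistic p ω))) := by
  obtain ⟨θ₀, v₀, hv₀⟩ := η₀
  simp only [Set.mem_Ioi] at hv₀ ht
  set w := L (0, 1) with hw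
  set u : Fin p → ℝ := fun i => L (EuclideanSpace.single i 1, 0) with hu
  have hβ : 0 < 1 / (2 * v₀) - t * w := by linarith
  -- The coefficient `w` of `‖x‖² + s` shifts the Gaussian quantity `1 / (2 v)` and the gamma rate
  -- by the same amount, so the tilted law again has one common variance parameter.
  set v := 1 / (2 * (1 / (2 * v₀) - t * w)) with hv
  have hvpos : 0 < v := by positivity
  have hinv : 1 / (2 * v) = 1 / (2 * v₀) - t * w := by rw [hv]; field_simp
  set θ : EuclideanSpace ℝ (Fin p) := WithLp.toLp 2 fun i => v * (θ₀ i / v₀ + t * u i) with hθ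
  have hn' : (0 : ℝ) < n := by exact_mod_cast hn
  have hG : ∀ i, ∃ C : ℝ, 0 < C ∧ gaussianReal (θ i) v.toNNReal =
      (gaussianReal (θ₀ i) v₀.toNNReal).withDensity
        fun x => ENNReal.ofReal (C * Real.exp (t * u i * x + t * w * x ^ 2)) := fun i => by
    refine gaussianReal_eq_withDensity_exp (by simpa using hv₀) (by simpa using hvpos) ?_ ?_
    · rw [Real.coe_toNNReal _ hvpos.le, Real.coe_toNNReal _ hv₀.le, hθ]
      field_simp
    · rw [Real.coe_toNNReal _ hvpos.le, Real.coe_toNNReal _ hv₀.le, hinv]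
  choose C hC hCG using hG
  obtain ⟨D, hD, hDG⟩ := gammaMeasure_eq_withDensity_exp (a := (n : ℝ) / 2) (b₀ := 1 / 2 / v₀)
    (b := 1 / 2 / v) (w := t * w) (by positivity) (by positivity) (by positivity)
    (by rw [div_div, div_div, hinv])
  refine ⟨(θ, ⟨v, hvpos⟩), (∏ i, C i) * D, mul_pos (Finset.prod_pos fun i _ => hC i) hD, ?_⟩
  have hpi : (Measure.pi fun i => gaussianReal (θ i) v.toNNReal).map (WithLp.toLp 2) =
      ((Measure.pi fun i => gaussianReal (θ₀ i) v₀.toNNReal).map (WithLp.toLp 2)).withDensity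
        fun x : EuclideanSpace ℝ (Fin p) => ENNReal.ofReal
          (∏ i, C i * Real.exp (t * u i * x i + t * w * x i ^ 2)) := by
    rw [← map_withDensity_comp _ (by fun_prop) (by fun_prop)]
    congr 1
    simp_rw [hCG]
    refine pi_withDensity_ofReal _ (fun i x => by have := hC i; positivity) fun i => ?_
    refine ⟨by fun_prop, ?_⟩
    -- The tilted density is integrable because the tilted law is known to be a probability measure.
    have h1 : IsProbabilityMeasure ((gaussianReal (θ₀ i) v₀.toNNReal).withDensity
        fun x => ENNReal.ofReal (C i * Real.exp (t * u i * x + t * w * x ^ 2))) := by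
      rw [← hCG]; infer_instance
    have h2 := h1.measure_univ
    rw [withDensity_apply _ MeasurableSet.univ, Measure.restrict_univ] at h2
    rw [hasFiniteIntegral_iff_ofReal (ae_of_all _ fun x => by have := hC i; positivity), h2]
    simp
  have : IsProbabilityMeasure (gammaMeasure ((n : ℝ) / 2) (1 / 2 / v₀)) :=
    isProbabilityMeasure_gammaMeasure (by positivity) (by positivity)
  have : IsProbabilityMeasure (gammaMeasure ((n : ℝ) / 2) (1 / 2 / v)) :=
    isProbabilityMeasure_gammaMeasure (by positivity) (by positivity)
  have : IsProbabilityMeasure ((gammaMeasure ((n : ℝ) / 2) (1 / 2 / v₀)).withDensity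
      fun x => ENNReal.ofReal (D * Real.exp (t * w * x))) := by
    rw [← hDG]; infer_instance
  have : IsProbabilityMeasure ((Measure.pi fun i => gaussianReal (θ i) v.toNNReal).map
      (WithLp.toLp 2)) := Measure.isProbabilityMeasure_map (by fun_prop)
  have : SFinite (((Measure.pi fun i => gaussianReal (θ₀ i) v₀.toNNReal).map
      (WithLp.toLp 2)).withDensity fun x : EuclideanSpace ℝ (Fin p) => ENNReal.ofReal
          (∏ i, C i * Real.exp (t * u i * x i + t * w * x i ^ 2))) := by
    rw [← hpi]; infer_instance
  rw [model_eq, model_eq]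
  dsimp only
  rw [hpi, hDG, prod_withDensity (by fun_prop) (by fun_prop)]
  congr 1
  funext ω
  rw [← ENNReal.ofReal_mul (Finset.prod_nonneg fun i _ => by have := hC i; positivity)]
  congr 1
  rw [Finset.prod_mul_distrib, ← Real.exp_sum]
  have hL : L (canonicalStatistic p ω) = ∑ i, u i * ω.1 i + w * (∑ i, ω.1 i ^ 2 + ω.2) := by
    rw [← EuclideanSpace.real_norm_sq_eq]
    exact dual_data_apply L _ _
  have hE : t * L (canonicalStatistic p ω) =
      (∑ i, (t * u i * ω.1 i + t * w * ω.1 i ^ 2)) + t * w * ω.2 := by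
    rw [hL, Finset.sum_add_distrib, mul_add, mul_add, mul_add, Finset.mul_sum, Finset.mul_sum,
      Finset.mul_sum]
    simp only [mul_assoc]
    ring
  rw [hE, Real.exp_add]
  ring

theorem isCompleteModel_model {p n : ℕ} (hn : 1 ≤ n) : IsCompleteModel (model p n) := by
  intro f hf η₀
  refine ae_eq_zero_of_integral_mul_exp_eq_zero (canonicalStatistic p).toMeasurableEquiv hf.1
    fun L => ?_
  have hv : (0 : ℝ) < η₀.2 := η₀.2.2
  have hev : ∀ᶠ t in 𝓝 (0 : ℝ), t * L (0, 1) < 1 / (2 * (η₀.2 : ℝ)) := by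
    have : Continuous fun t : ℝ => t * L (0, 1) := by fun_prop
    refine this.tendsto 0 |>.eventually (gt_mem_nhds ?_)
    rw [zero_mul]
    positivity
  filter_upwards [hev] with t ht
  -- Unbiasedness for zero at the tilted parameter `η` is, up to the factor `C`, the vanishing of
  -- the tilted integral at `η₀`.
  obtain ⟨η, C, hC, hη⟩ := exists_model_eq_withDensity_exp hn η₀ L ht
  have hm : Measurable fun ω => ENNReal.ofReal (C * Real.exp (t * L (canonicalStatistic p ω))) := by
    have := (canonicalStatistic p).measurable
    fun_prop
  obtain ⟨h1, h2⟩ := hf.2 η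
  rw [hη] at h1 h2
  rw [integrable_withDensity_iff hm (by simp)] at h1
  rw [integral_withDensity_eq_integral_toReal_smul hm (by simp)] at h2
  have hto : ∀ ω, (ENNReal.ofReal (C * Real.exp (t * L (canonicalStatistic p ω)))).toReal =
      C * Real.exp (t * L (canonicalStatistic p ω)) := fun ω =>
    ENNReal.toReal_ofReal (by positivity)
  simp only [hto, smul_eq_mul] at h1 h2
  constructor
  · refine (h1.const_mul C⁻¹).congr (ae_of_all _ fun ω => ?_)
    simp only [Homeomorph.toMeasurableEquiv_coe]
    field_simp
  · have h3 : C * ∫ ω, f ω * Real.exp (t * L ((canonicalStatistic p).toMeasurableEquiv ω))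
        ∂(model p n η₀) = 0 := by
      rw [← integral_const_mul, ← h2]
      refine integral_congr_ae (ae_of_all _ fun ω => ?_)
      simp only [Homeomorph.toMeasurableEquiv_coe]
      ring
    exact (mul_eq_zero.mp h3).resolve_left hC.ne'

end ModelCompleteness


/-! ### Integration by parts for Gaussian and gamma laws -/

section IntegrationByParts

open Filter Topology
open scoped NNReal

/-- The exceptional set is needed because both functions integrated by parts later, the shrinkage
term and `smoothedKernel`, have kinks. -/
theorem integral_eq_zero_of_hasDerivAt_off_countable {F F' : ℝ → ℝ} {s : Set ℝ}
    (hs : s.Countable) (hF : Continuous F) (hd : ∀ x ∉ s, HasDerivAt F (F' x) x)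
    (hi : Integrable F') (htop : Tendsto F atTop (𝓝 0)) (hbot : Tendsto F atBot (𝓝 0)) :
    ∫ x, F' x = 0 := by
  have h1 := intervalIntegral_tendsto_integral hi (tendsto_neg_atTop_atBot (G := ℝ)) tendsto_id
  have h2 : Tendsto (fun r : ℝ => F r - F (-r)) atTop (𝓝 (0 - 0)) :=
    htop.sub (hbot.comp tendsto_neg_atTop_atBot)
  rw [sub_zero] at h2
  refine tendsto_nhds_unique (h1.congr fun r => ?_) h2
  exact integral_eq_of_hasDerivAt_off_countable F F' hs hF.continuousOn
    (fun x hx => hd x hx.2) hi.intervalIntegrable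

theorem hasDerivAt_gaussianPDFReal (m : ℝ) {v : ℝ≥0} (hv : v ≠ 0) (x : ℝ) :
    HasDerivAt (gaussianPDFReal m v) (-((x - m) / v) * gaussianPDFReal m v x) x := by
  have hv' : (v : ℝ) ≠ 0 := by simpa using hv
  have h1 : HasDerivAt (fun x : ℝ => -(x - m) ^ 2 / (2 * v)) (-((x - m) / v)) x := by
    have := ((((hasDerivAt_id x).sub_const m).pow 2).neg).div_const (2 * (v : ℝ))
    refine this.congr_deriv ?_
    simp only [id, Nat.cast_ofNat]
    field_simp
    ring
  have h2 := (h1.exp).const_mul (√(2 * Real.pi * v))⁻¹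
  refine h2.congr_deriv ?_
  simp only [gaussianPDFReal]
  ring

theorem tendsto_gaussianPDFReal_cocompact (m : ℝ) {v : ℝ≥0} (hv : v ≠ 0) :
    Tendsto (gaussianPDFReal m v) (cocompact ℝ) (𝓝 0) := by
  have hv' : (0 : ℝ) < v := by positivity
  have h1 : Tendsto (fun x : ℝ => (x - m) ^ 2) (cocompact ℝ) atTop := by
    have : Tendsto (fun x : ℝ => ‖x - m‖ ^ 2) (cocompact ℝ) atTop :=
      (tendsto_pow_atTop two_ne_zero).comp (tendsto_norm_cocompact_atTop.comp
        (Homeomorph.addRight (-m)).isClosedEmbedding.tendsto_cocompact)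
    simpa using this
  have h2 : Tendsto (fun x : ℝ => Real.exp (-(x - m) ^ 2 / (2 * v))) (cocompact ℝ) (𝓝 0) := by
    refine Real.tendsto_exp_atBot.comp ?_
    have := (tendsto_neg_atTop_atBot.comp h1).atBot_div_const (r := 2 * (v : ℝ)) (by positivity)
    exact this
  have h3 := h2.const_mul (√(2 * Real.pi * v))⁻¹
  rw [mul_zero] at h3
  exact h3

theorem integrable_gaussianReal_iff {m : ℝ} {v : ℝ≥0} (hv : v ≠ 0) {f : ℝ → ℝ} :
    Integrable f (gaussianReal m v) ↔ Integrable fun x => f x * gaussianPDFReal m v x := by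
  rw [gaussianReal_of_var_ne_zero _ hv, integrable_withDensity_iff (measurable_gaussianPDF _ _)
    (ae_of_all _ fun x => gaussianPDF_lt_top)]
  simp only [toReal_gaussianPDF]

theorem integrable_of_abs_le {Ω : Type*} [MeasurableSpace Ω] {μ : Measure Ω} [IsFiniteMeasure μ]
    {f : Ω → ℝ} {B : ℝ} (hf : Measurable f) (hB : ∀ x, |f x| ≤ B) : Integrable f μ :=
  Integrable.of_bound hf.aestronglyMeasurable B (ae_of_all _ hB)

theorem integrable_sub_mul_of_abs_le {m a : ℝ} {v : ℝ≥0} {f : ℝ → ℝ} {B : ℝ}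
    (hf : Measurable f) (hB : ∀ x, |f x| ≤ B) :
    Integrable (fun x => (x - a) * f x) (gaussianReal m v) := by
  have h1 : Integrable (fun x : ℝ => x - a) (gaussianReal m v) :=
    IsGaussian.integrable_fun_id.sub (integrable_const a)
  exact h1.mul_bdd hf.aestronglyMeasurable (ae_of_all _ hB)

/-- **Stein's identity** for a bounded continuous function that is differentiable, with bounded
derivative, off a countable set. -/
theorem integral_sub_mul_gaussianReal {m : ℝ} {v : ℝ≥0} {f f' : ℝ → ℝ} {B B' : ℝ}
    {s : Set ℝ} (hs : s.Countable) (hf : Continuous f) (hd : ∀ x ∉ s, HasDerivAt f (f' x) x)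
    (hf' : Measurable f') (hB : ∀ x, |f x| ≤ B) (hB' : ∀ x, |f' x| ≤ B') :
    ∫ x, (x - m) * f x ∂(gaussianReal m v) = v * ∫ x, f' x ∂(gaussianReal m v) := by
  rcases eq_or_ne v 0 with rfl | hv
  · simp
  have hv' : (v : ℝ) ≠ 0 := by simpa using hv
  have h1 : Integrable (fun x => (x - m) * f x) (gaussianReal m v) :=
    integrable_sub_mul_of_abs_le hf.measurable hB
  have h2 : Integrable f' (gaussianReal m v) := integrable_of_abs_le hf' hB'
  have h3 : Integrable (fun x => f' x - (v : ℝ)⁻¹ * ((x - m) * f x)) (gaussianReal m v) :=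
    h2.sub (h1.const_mul _)
  have hlim : Tendsto (fun x => f x * gaussianPDFReal m v x) (cocompact ℝ) (𝓝 0) := by
    have h4 := (tendsto_gaussianPDFReal_cocompact m hv).const_mul B
    rw [mul_zero] at h4
    refine squeeze_zero_norm (fun x => ?_) h4
    rw [norm_mul, Real.norm_eq_abs, Real.norm_eq_abs, abs_of_nonneg (gaussianPDFReal_nonneg m v x)]
    exact mul_le_mul_of_nonneg_right (hB x) (gaussianPDFReal_nonneg m v x)
  -- With `φ` the density, `(f φ)' = (f' - (x - m) f / v) φ`, and `f φ` vanishes at both ends.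
  have key : ∫ x, (f' x - (v : ℝ)⁻¹ * ((x - m) * f x)) ∂(gaussianReal m v) = 0 := by
    rw [integral_gaussianReal_eq_integral_smul hv]
    refine integral_eq_zero_of_hasDerivAt_off_countable
      (F := fun x => f x * gaussianPDFReal m v x) hs
      (hf.mul (continuous_iff_continuousAt.mpr fun x =>
        (hasDerivAt_gaussianPDFReal m hv x).continuousAt)) (fun x hx => ?_) ?_ ?_ ?_
    · refine ((hd x hx).mul (hasDerivAt_gaussianPDFReal m hv x)).congr_deriv ?_
      simp only [smul_eq_mul]
      field_simp
      ring
    · refine ((integrable_gaussianReal_iff hv).mp h3).congr (ae_of_all _ fun x => ?_)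
      simp only [smul_eq_mul]
      ring
    · exact hlim.mono_left atTop_le_cocompact
    · exact hlim.mono_left atBot_le_cocompact
  rw [integral_sub h2 (h1.const_mul _), integral_const_mul] at key
  field_simp at key
  linarith

theorem integrable_sub_mul_pi {ι : Type*} [Fintype ι] {m : ι → ℝ} {v : ℝ≥0} {a : ℝ} (j : ι)
    {f : (ι → ℝ) → ℝ} {B : ℝ} (hf : Measurable f) (hB : ∀ x, |f x| ≤ B) :
    Integrable (fun x => (x j - a) * f x) (Measure.pi fun i => gaussianReal (m i) v) := by
  have h1 : Integrable (fun x : ι → ℝ => x j - a) (Measure.pi fun i => gaussianReal (m i) v) :=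
    (integrable_comp_eval (μ := fun i => gaussianReal (m i) v) (i := j)
      (f := fun y : ℝ => y) IsGaussian.integrable_fun_id).sub (integrable_const a)
  exact h1.mul_bdd hf.aestronglyMeasurable (ae_of_all _ hB)

/-- Stein's identity in one coordinate of a vector of independent normal variables. -/
theorem integral_sub_mul_pi_gaussianReal {k : ℕ} {m : Fin (k + 1) → ℝ} {v : ℝ≥0}
    (j : Fin (k + 1)) {f f' : (Fin (k + 1) → ℝ) → ℝ} {B B' : ℝ}
    (hf : Continuous f) (hd : ∀ x : Fin (k + 1) → ℝ, ∃ s : Set ℝ, s.Countable ∧ ∀ t ∉ s,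
      HasDerivAt (fun t => f (Function.update x j t)) (f' (Function.update x j t)) t)
    (hf' : Measurable f') (hB : ∀ x, |f x| ≤ B) (hB' : ∀ x, |f' x| ≤ B') :
    ∫ x, (x j - m j) * f x ∂(Measure.pi fun i => gaussianReal (m i) v) =
      v * ∫ x, f' x ∂(Measure.pi fun i => gaussianReal (m i) v) := by
  set μ : Fin (k + 1) → Measure ℝ := fun i => gaussianReal (m i) v with hμ
  have hmp := (measurePreserving_piFinSuccAbove μ j).symm
  -- Coordinate `j` is split off by Fubini, and the one-dimensional identity is applied along each
  -- line parallel to that axis.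
  set e := (MeasurableEquiv.piFinSuccAbove (fun _ : Fin (k + 1) => ℝ) j).symm with he
  have hej : ∀ t y, e (t, y) j = t := fun t y => by simp [he]
  have hupd : ∀ t y, e (t, y) = Function.update (e (0, y)) j t := fun t y => by
    funext i
    rcases Fin.eq_self_or_eq_succAbove j i with rfl | ⟨i, rfl⟩
    · simp [he]
    · simp [he]
  have hupdc : ∀ y, Continuous fun t : ℝ => Function.update (e (0, y)) j t := fun y =>
    continuous_const.update j continuous_id
  have i1 : Integrable (fun x => (x j - m j) * f x) (Measure.pi μ) :=
    integrable_sub_mul_pi j hf.measurable hB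
  have i2 : Integrable f' (Measure.pi μ) := integrable_of_abs_le hf' hB'
  have j1 := hmp.integrable_comp_of_integrable i1
  have j2 := hmp.integrable_comp_of_integrable i2
  simp only [Function.comp_def] at j1 j2
  rw [← hmp.integral_comp', ← hmp.integral_comp', integral_prod_symm _ j1,
    integral_prod_symm _ j2, ← integral_const_mul]
  refine integral_congr_ae (ae_of_all _ fun y => ?_)
  obtain ⟨s, hs, hsd⟩ := hd (e (0, y))
  have := integral_sub_mul_gaussianReal (m := m j) (v := v) hs (hf.comp (hupdc y)) hsd
    (hf'.comp (hupdc y).measurable) (fun x => hB _) (fun x => hB' _)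
  simp only [Function.comp, ← hupd] at this
  simp only [hej]
  exact this

theorem integrable_gammaMeasure_iff {a b : ℝ} (ha : 0 < a) (hb : 0 < b) {f : ℝ → ℝ} :
    Integrable f (gammaMeasure a b) ↔
      IntegrableOn (fun s => f s * (s ^ (a - 1) * Real.exp (-(b * s)))) (Set.Ioi 0) := by
  have hm : Measurable (gammaPDF a b) := (measurable_gammaPDFReal a b).ennreal_ofReal
  have hc : b ^ a / Real.Gamma a ≠ 0 :=
    (div_pos (Real.rpow_pos_of_pos hb a) (Real.Gamma_pos_of_pos ha)).ne'
  rw [gammaMeasure, integrable_withDensity_iff hm (by simp [gammaPDF]),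
    ← integrable_indicator_iff measurableSet_Ioi, ← integrable_const_mul_iff hc.isUnit ((Set.Ioi 0).indicator _)]
  refine integrable_congr ?_
  filter_upwards [compl_mem_ae_iff.mpr (measure_singleton (0 : ℝ))] with s hs
  have hs0 : s ≠ 0 := hs
  rw [gammaPDF, ENNReal.toReal_ofReal (gammaPDFReal_nonneg ha hb s), gammaPDFReal]
  rcases lt_or_gt_of_ne hs0 with h | h
  · rw [if_neg (by linarith), Set.indicator_of_notMem (by simpa using h.le)]
    simp
  · rw [if_pos h.le, Set.indicator_of_mem (by simpa using h)]
    ring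

theorem integral_gammaMeasure {a b : ℝ} (ha : 0 < a) (hb : 0 < b) (f : ℝ → ℝ) :
    ∫ s, f s ∂(gammaMeasure a b) = b ^ a / Real.Gamma a *
      ∫ s in Set.Ioi 0, f s * (s ^ (a - 1) * Real.exp (-(b * s))) := by
  have hm : Measurable (gammaPDF a b) := (measurable_gammaPDFReal a b).ennreal_ofReal
  rw [gammaMeasure, integral_withDensity_eq_integral_toReal_smul hm (by simp [gammaPDF]),
    ← integral_indicator measurableSet_Ioi, ← integral_const_mul]
  refine integral_congr_ae ?_
  filter_upwards [compl_mem_ae_iff.mpr (measure_singleton (0 : ℝ))] with s hs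
  have hs0 : s ≠ 0 := hs
  rw [gammaPDF, ENNReal.toReal_ofReal (gammaPDFReal_nonneg ha hb s), gammaPDFReal]
  rcases lt_or_gt_of_ne hs0 with h | h
  · rw [if_neg (by linarith), Set.indicator_of_notMem (by simpa using h.le)]
    simp
  · rw [if_pos h.le, Set.indicator_of_mem (by simpa using h), smul_eq_mul]
    ring

theorem ae_pos_gammaMeasure (a b : ℝ) : ∀ᵐ s ∂(gammaMeasure a b), 0 < s := by
  have hm : Measurable (gammaPDF a b) := (measurable_gammaPDFReal a b).ennreal_ofReal
  rw [gammaMeasure, ae_withDensity_iff hm]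
  filter_upwards [compl_mem_ae_iff.mpr (measure_singleton (0 : ℝ))] with s hs h
  have hs0 : s ≠ 0 := hs
  by_contra h0
  exact h (gammaPDF_of_neg (lt_of_le_of_ne (not_lt.mp h0) hs0))

theorem integrable_pow_gammaMeasure {a b : ℝ} (ha : 0 < a) (hb : 0 < b) (k : ℕ) :
    Integrable (fun s => s ^ k) (gammaMeasure a b) := by
  rw [integrable_gammaMeasure_iff ha hb]
  have h := integrableOn_rpow_mul_exp_neg_mul_rpow (p := 1) (s := a + k - 1) (b := b)
    (by have : (0 : ℝ) ≤ k := by positivity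
        linarith) one_pos hb
  refine h.congr_fun (fun s hs => ?_) measurableSet_Ioi
  have hs' : (0 : ℝ) < s := hs
  simp only [Real.rpow_one]
  rw [show a + k - 1 = (k : ℝ) + (a - 1) by ring, Real.rpow_add hs', Real.rpow_natCast]
  ring_nf

/-- Integration by parts for the gamma distribution. -/
theorem integral_gammaMeasure_eq_of_hasDerivAt {a b : ℝ} (ha : 0 < a) (hb : 0 < b)
    {K k : ℝ → ℝ} {B : ℝ} {s₀ : Set ℝ} (hs₀ : s₀.Countable) (hK : ContinuousOn K (Set.Ioi 0))
    (hKm : Measurable K) (hkm : Measurable k) (hKB : ∀ s, 0 < s → |K s| ≤ B * s)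
    (hkB : ∀ s, 0 < s → |k s| ≤ B)
    (hd : ∀ s, 0 < s → s ∉ s₀ → HasDerivAt K (k s / 2 - (a - 1) * (K s / s)) s) :
    ∫ s, k s ∂(gammaMeasure a b) = 2 * b * ∫ s, K s ∂(gammaMeasure a b) := by
  have := isProbabilityMeasure_gammaMeasure ha hb
  have hki : Integrable k (gammaMeasure a b) :=
    Integrable.of_bound hkm.aestronglyMeasurable B <| by
      filter_upwards [ae_pos_gammaMeasure a b] with s hs using hkB s hs
  have hKi : Integrable K (gammaMeasure a b) := by
    refine ((integrable_pow_gammaMeasure ha hb 1).const_mul B).mono' hKm.aestronglyMeasurable ?_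
    filter_upwards [ae_pos_gammaMeasure a b] with s hs
    simpa using hKB s hs
  have hi : Integrable (fun s => k s - 2 * b * K s) (gammaMeasure a b) :=
    hki.sub (hKi.const_mul _)
  have key : ∫ s, (k s - 2 * b * K s) ∂(gammaMeasure a b) = 0 := by
    rw [integral_gammaMeasure ha hb]
    rw [integrable_gammaMeasure_iff ha hb] at hi
    refine mul_eq_zero_of_right _ ?_
    rw [← integral_indicator measurableSet_Ioi]
    rw [← integrable_indicator_iff measurableSet_Ioi] at hi
    -- Hypothesis `hd` says `(s^{a-1} K)' = s^{a-1} k / 2`, so `F' = (k - 2 b K) s^{a-1} e^{-bs}` on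
    -- the half-line. The bound `|K| ≤ B s` gives `|F| ≤ 2 B s^a e^{-bs}`, hence continuity of the
    -- extension by zero at 0 even when `a < 1`, and decay at infinity.
    set F : ℝ → ℝ := (Set.Ioi 0).indicator
      fun s => 2 * (K s * (s ^ (a - 1) * Real.exp (-(b * s)))) with hF
    have hFB : ∀ s, |F s| ≤ 2 * B * (|s| ^ a * Real.exp (-(b * s))) := by
      intro s
      have hB0 : 0 ≤ B := (abs_nonneg _).trans (hkB 1 one_pos)
      rcases le_or_gt s 0 with h | h
      · rw [hF, Set.indicator_of_notMem (by simpa using h), abs_zero]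
        positivity
      · rw [hF, Set.indicator_of_mem (by simpa using h), abs_mul, abs_mul, abs_of_pos two_pos,
          abs_of_pos (by positivity : 0 < s ^ (a - 1) * Real.exp (-(b * s))), abs_of_pos h,
          Real.rpow_sub_one h.ne']
        have h1 := hKB s h
        calc 2 * (|K s| * (s ^ a / s * Real.exp (-(b * s))))
            ≤ 2 * ((B * s) * (s ^ a / s * Real.exp (-(b * s)))) := by gcongr
          _ = _ := by field_simp
    have hderiv : ∀ s, 0 < s → s ∉ s₀ → HasDerivAt F
        ((k s - 2 * b * K s) * (s ^ (a - 1) * Real.exp (-(b * s)))) s := by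
      intro s hs h
      have hev : F =ᶠ[𝓝 s] fun s => 2 * (K s * (s ^ (a - 1) * Real.exp (-(b * s)))) := by
        filter_upwards [Ioi_mem_nhds hs] with y hy
        rw [hF, Set.indicator_of_mem hy]
      refine HasDerivAt.congr_of_eventuallyEq ?_ hev
      have e1 : HasDerivAt (fun s : ℝ => Real.exp (-(b * s))) (Real.exp (-(b * s)) * (-b)) s := by
        have := (((hasDerivAt_id s).const_mul b).neg).exp
        simpa using this
      have e2 := Real.hasDerivAt_rpow_const (x := s) (p := a - 1) (Or.inl hs.ne')
      refine (((hd s hs h).mul (e2.mul e1)).const_mul 2).congr_deriv ?_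
      simp only [Pi.mul_apply]
      rw [Real.rpow_sub_one hs.ne' (a - 1)]
      field_simp
      ring
    refine integral_eq_zero_of_hasDerivAt_off_countable (F := F) (s := insert 0 s₀)
      (hs₀.insert 0) ?_ ?_ hi ?_ ?_
    · refine continuous_iff_continuousAt.mpr fun s => ?_
      rcases lt_trichotomy s 0 with h | rfl | h
      · have hev : F =ᶠ[𝓝 s] fun _ => 0 := by
          filter_upwards [Iio_mem_nhds h] with y hy
          rw [hF, Set.indicator_of_notMem (by simpa using (le_of_lt hy))]
        exact continuousAt_const.congr hev.symm
      · have h0 : F 0 = 0 := by simp [hF]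
        rw [ContinuousAt, h0]
        have hc : Continuous fun s : ℝ => 2 * B * (|s| ^ a * Real.exp (-(b * s))) := by
          have : Continuous fun s : ℝ => |s| ^ a := continuous_abs.rpow_const fun _ => Or.inr ha.le
          fun_prop
        have := hc.tendsto 0
        simp only [abs_zero, Real.zero_rpow ha.ne', zero_mul, mul_zero] at this
        exact squeeze_zero_norm hFB this
      · have hev : F =ᶠ[𝓝 s] fun s => 2 * (K s * (s ^ (a - 1) * Real.exp (-(b * s)))) := by
          filter_upwards [Ioi_mem_nhds h] with y hy
          rw [hF, Set.indicator_of_mem hy]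
        refine ContinuousAt.congr ?_ hev.symm
        have e2 := Real.continuousAt_rpow_const s (a - 1) (Or.inl h.ne')
        have e3 : ContinuousAt K s := hK.continuousAt (Ioi_mem_nhds h)
        fun_prop
    · intro s hs
      simp only [Set.mem_insert_iff, not_or] at hs
      rcases lt_or_gt_of_ne hs.1 with h | h
      · rw [Set.indicator_of_notMem (by simpa using h.le)]
        have hev : F =ᶠ[𝓝 s] fun _ => 0 := by
          filter_upwards [Iio_mem_nhds h] with y hy
          rw [hF, Set.indicator_of_notMem (by simpa using (le_of_lt hy))]
        exact (hasDerivAt_const s (0 : ℝ)).congr_of_eventuallyEq hev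
      · rw [Set.indicator_of_mem (by simpa using h)]
        exact hderiv s h hs.2
    · have h1 := (tendsto_rpow_mul_exp_neg_mul_atTop_nhds_zero a b hb).const_mul (2 * B)
      rw [mul_zero] at h1
      refine squeeze_zero_norm' ?_ h1
      filter_upwards [eventually_gt_atTop 0] with s hs
      have := hFB s
      rw [abs_of_pos hs] at this
      rw [Real.norm_eq_abs, neg_mul]
      exact this
    · refine tendsto_const_nhds.congr' ?_
      filter_upwards [eventually_lt_atBot 0] with s hs
      rw [hF, Set.indicator_of_notMem (by simpa using hs.le)]
  rw [integral_sub hki (hKi.const_mul _), integral_const_mul] at key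
  linarith

end IntegrationByParts


/-! ### Absorbing the unknown variance by integrating in `s` -/

section Kernel

open Filter Topology

/-- The factor `δ / r - 2 y / r²`, which for `r = ‖x‖²`, `y = xᵢ xⱼ` is `∂ⱼ (xᵢ / ‖x‖²)`. -/
def radialFactor (δ r y : ℝ) : ℝ := δ / r - 2 * y / r ^ 2

/-- The partial derivative of a coordinate of the shrinkage term, as a function of `s`. -/
def derivKernel (c δ r y s : ℝ) : ℝ :=
  if r ≤ c * s then -δ else -(c * s * radialFactor δ r y)

/-- The function of `s` whose expectation is `σ²` times that of `derivKernel`. -/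
def smoothedKernel (n : ℕ) (c δ r y s : ℝ) : ℝ :=
  if r ≤ c * s then
    s * (-(δ / n) + (r / (c * s)) ^ ((n : ℝ) / 2) * (δ / n - r * radialFactor δ r y / (n + 2)))
  else -(c * s ^ 2 * radialFactor δ r y / (n + 2))

variable {c δ r y : ℝ}

/-- The factor is singular at `r = 0`, but the kernels use it only multiplied by `r`, or by `c s`
where `c s < r`. This single estimate therefore bounds both. -/
theorem mul_abs_radialFactor_le (hr : 0 ≤ r) (hδ : |δ| ≤ 1) (hy : |y| ≤ r) :
    r * |radialFactor δ r y| ≤ 3 := by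
  rcases hr.eq_or_lt with rfl | hr
  · simp
  have h1 : r * |radialFactor δ r y| = |δ - 2 * (y / r)| := by
    rw [← abs_of_pos hr, ← abs_mul, abs_of_pos hr, radialFactor]
    congr 1
    field_simp
  have h2 : |y / r| ≤ 1 := by
    rw [abs_div, abs_of_pos hr, div_le_one hr]
    exact hy
  rw [h1]
  calc |δ - 2 * (y / r)| ≤ |δ| + |2 * (y / r)| := abs_sub _ _
    _ = |δ| + 2 * |y / r| := by rw [abs_mul, abs_two]
    _ ≤ 3 := by linarith

theorem abs_derivKernel_le (hc : 0 < c) (hr : 0 ≤ r) (hδ : |δ| ≤ 1) (hy : |y| ≤ r) {s : ℝ}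
    (hs : 0 < s) : |derivKernel c δ r y s| ≤ 3 := by
  unfold derivKernel
  split_ifs with h
  · rw [abs_neg]; linarith
  · rw [abs_neg, abs_mul, abs_of_pos (mul_pos hc hs)]
    refine le_trans ?_ (mul_abs_radialFactor_le hr hδ hy)
    gcongr
    linarith

theorem abs_smoothedKernel_le {n : ℕ} (hn : 1 ≤ n) (hc : 0 < c) (hr : 0 ≤ r) (hδ : |δ| ≤ 1)
    (hy : |y| ≤ r) {s : ℝ} (hs : 0 < s) : |smoothedKernel n c δ r y s| ≤ 5 * s := by
  have hn' : (1 : ℝ) ≤ n := by exact_mod_cast hn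
  have hq := mul_abs_radialFactor_le hr hδ hy
  have hδn : |δ / n| ≤ 1 := by
    rw [abs_div, Nat.abs_cast, div_le_one (by linarith)]
    exact hδ.trans hn'
  unfold smoothedKernel
  split_ifs with h
  · have h1 : |r * radialFactor δ r y / (n + 2)| ≤ 1 := by
      rw [abs_div, abs_mul, abs_of_nonneg hr, abs_of_pos (by linarith : (0 : ℝ) < n + 2),
        div_le_one (by linarith)]
      linarith
    have h2 : |(r / (c * s)) ^ ((n : ℝ) / 2)| ≤ 1 := by
      have h0 : 0 ≤ r / (c * s) := by positivity
      rw [abs_of_nonneg (Real.rpow_nonneg h0 _)]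
      exact Real.rpow_le_one h0 (by rw [div_le_one (by positivity)]; exact h) (by positivity)
    rw [abs_mul, abs_of_pos hs, mul_comm]
    gcongr
    calc |-(δ / n) + (r / (c * s)) ^ ((n : ℝ) / 2) * (δ / n - r * radialFactor δ r y / (n + 2))|
        ≤ |-(δ / n)| + |(r / (c * s)) ^ ((n : ℝ) / 2)| *
          (|δ / n| + |r * radialFactor δ r y / (n + 2)|) := by
          refine (abs_add_le _ _).trans ?_
          rw [abs_mul]
          gcongr
          exact abs_sub _ _
      _ ≤ 1 + 1 * (1 + 1) := by
          rw [abs_neg]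
          gcongr
      _ ≤ 5 := by norm_num
  · have h1 : c * s * |radialFactor δ r y| ≤ 3 := by
      refine le_trans ?_ hq
      gcongr
      linarith
    rw [abs_neg, abs_div, abs_mul, abs_of_pos (by positivity : 0 < c * s ^ 2),
      abs_of_pos (by linarith : (0 : ℝ) < n + 2), div_le_iff₀ (by linarith)]
    calc c * s ^ 2 * |radialFactor δ r y| = s * (c * s * |radialFactor δ r y|) := by ring
      _ ≤ s * 3 := by gcongr
      _ ≤ 5 * s * (n + 2) := by nlinarith

/-- At `r = c s` the power equals 1, and its coefficient is exactly the jump between the two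
particular solutions. -/
theorem continuousOn_smoothedKernel {n : ℕ} (hn : 1 ≤ n) (hc : 0 < c) :
    ContinuousOn (smoothedKernel n c δ r y) (Set.Ioi 0) := by
  have hn' : (1 : ℝ) ≤ n := by exact_mod_cast hn
  rw [continuousOn_iff_continuous_domRestrict]
  unfold smoothedKernel Set.domRestrict
  have hne : ∀ s : Set.Ioi (0 : ℝ), c * (s : ℝ) ≠ 0 := fun s => (mul_pos hc s.2).ne'
  refine Continuous.if_le ?_ ?_ (by fun_prop) (by fun_prop) ?_
  · have h1 : Continuous fun s : Set.Ioi (0 : ℝ) => (r / (c * (s : ℝ))) ^ ((n : ℝ) / 2) :=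
      (Continuous.div continuous_const (by fun_prop) hne).rpow_const
        fun s => Or.inr (by positivity)
    fun_prop
  · fun_prop
  · intro s hs
    have hs0 : (0 : ℝ) < s := s.2
    rw [← hs, div_self (by rw [hs]; exact hne s), Real.one_rpow]
    have : r = c * s := hs
    field_simp
    rw [this]
    ring

/-- With `a = n / 2`, the equation is `(s^{a-1} K)' = s^{a-1} k / 2`. The particular solutions are
`-c s² ρ / (n + 2)` for `k = -c s ρ` and `-δ s / n` for `k = -δ`, where `ρ` is the radial factor.
The term `s (r / (c s))^a` is a multiple of the homogeneous solution `s^{1-a}`. -/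
theorem hasDerivAt_smoothedKernel {n : ℕ} (hn : 1 ≤ n) (hc : 0 < c) (hr : 0 ≤ r) {s : ℝ}
    (hs : 0 < s) (hne : s ≠ r / c) :
    HasDerivAt (smoothedKernel n c δ r y)
      (derivKernel c δ r y s / 2 - ((n : ℝ) / 2 - 1) * (smoothedKernel n c δ r y s / s)) s := by
  have hn' : (0 : ℝ) < n := by exact_mod_cast hn
  rcases lt_or_gt_of_ne hne with h | h
  · have h' : ∀ u, u < r / c → ¬ r ≤ c * u := fun u hu => by
      rw [lt_div_iff₀ hc] at hu
      linarith
    have hev : smoothedKernel n c δ r y =ᶠ[𝓝 s]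
        fun s => -(c * s ^ 2 * radialFactor δ r y / (n + 2)) := by
      filter_upwards [Iio_mem_nhds h] with u hu
      rw [smoothedKernel, if_neg (h' u hu)]
    refine HasDerivAt.congr_of_eventuallyEq ?_ hev
    have e := (((((hasDerivAt_pow 2 s).const_mul c).mul_const (radialFactor δ r y)).div_const
      ((n : ℝ) + 2))).neg
    refine e.congr_deriv ?_
    rw [smoothedKernel, derivKernel, if_neg (h' s h), if_neg (h' s h)]
    have : (n : ℝ) + 2 ≠ 0 := by positivity
    field_simp
    ring
  · have h' : ∀ u, r / c < u → r ≤ c * u := fun u hu => by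
      rw [div_lt_iff₀ hc] at hu
      linarith
    set a : ℝ := (n : ℝ) / 2 with ha
    set D : ℝ := δ / n - r * radialFactor δ r y / (n + 2) with hD
    have hpow : ∀ u, 0 < u → (r / (c * u)) ^ a = (r / c) ^ a * u ^ (-a) := fun u hu => by
      rw [Real.rpow_neg hu.le, ← div_div, Real.div_rpow (by positivity) hu.le, div_eq_mul_inv]
    have hev : smoothedKernel n c δ r y =ᶠ[𝓝 s]
        fun s => s * (-(δ / n) + (r / c) ^ a * s ^ (-a) * D) := by
      filter_upwards [Ioi_mem_nhds h, Ioi_mem_nhds hs] with u hu hu0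
      rw [smoothedKernel, if_pos (h' u hu), hpow u hu0]
    have hval : smoothedKernel n c δ r y s = s * (-(δ / n) + (r / c) ^ a * s ^ (-a) * D) :=
      hev.self_of_nhds
    refine HasDerivAt.congr_of_eventuallyEq ?_ hev
    have e1 := Real.hasDerivAt_rpow_const (x := s) (p := -a) (Or.inl hs.ne')
    have e := (hasDerivAt_id s).mul (((e1.const_mul ((r / c) ^ a)).mul_const D).const_add (-(δ / n)))
    refine e.congr_deriv ?_
    rw [hval, derivKernel, if_pos (h' s h), Real.rpow_sub_one hs.ne', id]
    field_simp
    rw [ha]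
    field_simp
    ring

theorem measurable_derivKernel : Measurable (derivKernel c δ r y) := by
  unfold derivKernel
  exact Measurable.ite (measurableSet_le measurable_const (by fun_prop)) (by fun_prop) (by fun_prop)

theorem measurable_smoothedKernel {n : ℕ} : Measurable (smoothedKernel n c δ r y) := by
  unfold smoothedKernel
  exact Measurable.ite (measurableSet_le measurable_const (by fun_prop)) (by fun_prop) (by fun_prop)

theorem integral_smoothedKernel {n : ℕ} (hn : 1 ≤ n) (hc : 0 < c) (hr : 0 ≤ r) (hδ : |δ| ≤ 1)
    (hy : |y| ≤ r) {v : ℝ} (hv : 0 < v) :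
    ∫ s, smoothedKernel n c δ r y s ∂(gammaMeasure ((n : ℝ) / 2) (1 / 2 / v)) =
      v * ∫ s, derivKernel c δ r y s ∂(gammaMeasure ((n : ℝ) / 2) (1 / 2 / v)) := by
  have hn' : (0 : ℝ) < n := by exact_mod_cast hn
  rw [integral_gammaMeasure_eq_of_hasDerivAt (s₀ := {r / c}) (B := 5) (by positivity)
    (by positivity) (Set.countable_singleton _) (continuousOn_smoothedKernel hn hc)
    measurable_smoothedKernel measurable_derivKernel
    (fun s hs => abs_smoothedKernel_le hn hc hr hδ hy hs)
    (fun s hs => (abs_derivKernel_le hc hr hδ hy hs).trans (by norm_num))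
    (fun s hs hne => hasDerivAt_smoothedKernel hn hc hr hs hne)]
  field_simp

/-- The same integration by parts with `k = 1` and `K = s / n`. -/
theorem integral_id_gammaMeasure {n : ℕ} (hn : 1 ≤ n) {v : ℝ} (hv : 0 < v) :
    ∫ s, s / n ∂(gammaMeasure ((n : ℝ) / 2) (1 / 2 / v)) = v := by
  have hn' : (1 : ℝ) ≤ n := by exact_mod_cast hn
  have := isProbabilityMeasure_gammaMeasure (a := (n : ℝ) / 2) (r := 1 / 2 / v) (by positivity)
    (by positivity)
  have h := integral_gammaMeasure_eq_of_hasDerivAt (a := (n : ℝ) / 2) (b := 1 / 2 / v)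
    (K := fun s => s / n) (k := fun _ => 1) (s₀ := ∅) (B := 1) (by positivity) (by positivity)
    Set.countable_empty (by fun_prop) (by fun_prop) (by fun_prop)
    (fun s hs => by
      rw [abs_div, abs_of_pos hs, abs_of_pos (by linarith), one_mul]
      exact div_le_self hs.le hn') (by simp)
    (fun s hs _ => by
      refine ((hasDerivAt_id s).div_const (n : ℝ)).congr_deriv ?_
      field_simp
      ring)
  simp only [integral_const, probReal_univ, smul_eq_mul, mul_one] at h
  rw [show 2 * (1 / 2 / v) = v⁻¹ by field_simp] at h
  rw [eq_inv_mul_iff_mul_eq₀ hv.ne', mul_one] at h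
  exact h.symm

end Kernel

/-! ### Stein's identity for the shrinkage term -/

section Shrinkage

open Filter Topology
open scoped NNReal

variable {p : ℕ}

/-- The `i`-th coordinate of `δ⁺ - X` where `S > 0`. -/
def shrinkTerm (d : ℝ) (i : Fin p) (x : EuclideanSpace ℝ (Fin p)) : ℝ :=
  -(d / max d (‖x‖ ^ 2) * x i)

theorem abs_coord_mul_le (x : EuclideanSpace ℝ (Fin p)) (i j : Fin p) :
    |x i * x j| ≤ ‖x‖ ^ 2 := by
  rw [abs_mul, sq]
  gcongr
  · exact PiLp.norm_apply_le x i
  · exact PiLp.norm_apply_le x j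

theorem continuous_shrinkTerm {d : ℝ} (hd : 0 < d) (i : Fin p) : Continuous (shrinkTerm d i) := by
  unfold shrinkTerm
  have : ∀ x : EuclideanSpace ℝ (Fin p), max d (‖x‖ ^ 2) ≠ 0 := fun x =>
    (lt_max_of_lt_left hd).ne'
  fun_prop (disch := assumption)

theorem abs_shrinkTerm_le {d : ℝ} (hd : 0 < d) (i : Fin p) (x : EuclideanSpace ℝ (Fin p)) :
    |shrinkTerm d i x| ≤ |x i| := by
  have h : 0 < max d (‖x‖ ^ 2) := lt_max_of_lt_left hd
  rw [shrinkTerm, abs_neg, abs_mul, abs_of_pos (by positivity)]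
  refine mul_le_of_le_one_left (abs_nonneg _) ?_
  rw [div_le_one h]
  exact le_max_left _ _

/-- The squared length of the shrinkage vector is at most `d² / max d r ≤ d`. With `d = c S` this
makes the quadratic term of order `S`. -/
theorem abs_shrinkTerm_mul_le {d : ℝ} (hd : 0 < d) (i j : Fin p)
    (x : EuclideanSpace ℝ (Fin p)) : |shrinkTerm d i x * shrinkTerm d j x| ≤ d := by
  have h : 0 < max d (‖x‖ ^ 2) := lt_max_of_lt_left hd
  have e : shrinkTerm d i x * shrinkTerm d j x =
      (d / max d (‖x‖ ^ 2)) ^ 2 * (x i * x j) := by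
    rw [shrinkTerm, shrinkTerm]; ring
  rw [e, abs_mul, abs_of_pos (by positivity)]
  calc (d / max d (‖x‖ ^ 2)) ^ 2 * |x i * x j|
      ≤ (d / max d (‖x‖ ^ 2)) ^ 2 * max d (‖x‖ ^ 2) := by
        gcongr
        exact (abs_coord_mul_le x i j).trans (le_max_right _ _)
    _ = d * (d / max d (‖x‖ ^ 2)) := by field_simp
    _ ≤ d * 1 := by
        gcongr
        rw [div_le_one h]
        exact le_max_left _ _
    _ = d := mul_one d

theorem abs_shrinkTerm_le_add {d : ℝ} (hd : 0 < d) (i : Fin p)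
    (x : EuclideanSpace ℝ (Fin p)) : |shrinkTerm d i x| ≤ d + 1 := by
  have h := abs_shrinkTerm_mul_le hd i i x
  rw [abs_mul] at h
  nlinarith [abs_nonneg (shrinkTerm d i x), sq_nonneg (|shrinkTerm d i x| - 1)]

theorem norm_sq_toLp_update (x : Fin p → ℝ) (j : Fin p) (t : ℝ) :
    ‖(WithLp.toLp 2 (Function.update x j t) : EuclideanSpace ℝ (Fin p))‖ ^ 2 =
      ‖(WithLp.toLp 2 (Function.update x j 0) : EuclideanSpace ℝ (Fin p))‖ ^ 2 + t ^ 2 := by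
  rw [EuclideanSpace.real_norm_sq_eq, EuclideanSpace.real_norm_sq_eq]
  have : ∀ l, Function.update x j t l ^ 2 =
      Function.update x j 0 l ^ 2 + if l = j then t ^ 2 else 0 := fun l => by
    by_cases h : l = j
    · subst h; simp
    · simp [h]
  simp only [this, Finset.sum_add_distrib, Finset.sum_ite_eq', Finset.mem_univ, if_true]

/-- A line meets the sphere `‖x‖² = d`, where the shrinkage term has its kink, in at most two
points. -/
theorem countable_setOf_const_add_sq_eq (A d : ℝ) : {t : ℝ | A + t ^ 2 = d}.Countable := by
  refine (((Set.finite_singleton (-√(d - A))).insert (√(d - A))).subset fun t ht => ?_).countable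
  have h : t ^ 2 = d - A := by
    have : A + t ^ 2 = d := ht
    linarith
  have h0 : 0 ≤ d - A := h ▸ sq_nonneg t
  rw [← Real.sq_sqrt h0] at h
  exact sq_eq_sq_iff_eq_or_eq_neg.mp h

theorem hasDerivAt_shrinkTerm_update {d : ℝ} (i j : Fin p) (x : Fin p → ℝ) (t : ℝ)
    (ht : ‖(WithLp.toLp 2 (Function.update x j t) : EuclideanSpace ℝ (Fin p))‖ ^ 2 ≠ d)
    (hd : 0 < d) :
    HasDerivAt (fun t => shrinkTerm d i (WithLp.toLp 2 (Function.update x j t)))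
      (if ‖(WithLp.toLp 2 (Function.update x j t) : EuclideanSpace ℝ (Fin p))‖ ^ 2 ≤ d then
          -(if i = j then 1 else 0) else
        -(d * radialFactor (if i = j then 1 else 0)
          (‖(WithLp.toLp 2 (Function.update x j t) : EuclideanSpace ℝ (Fin p))‖ ^ 2)
          (Function.update x j t i * Function.update x j t j))) t := by
  obtain ⟨A, hA⟩ : ∃ A, ∀ u, ‖(WithLp.toLp 2 (Function.update x j u) :
      EuclideanSpace ℝ (Fin p))‖ ^ 2 = A + u ^ 2 := ⟨_, norm_sq_toLp_update x j⟩
  have hx : HasDerivAt (fun t => Function.update x j t i) (if i = j then 1 else 0) t := by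
    have := hasDerivAt_pi.mp (hasDerivAt_update x j t) i
    simpa [Pi.single_apply] using this
  simp only [shrinkTerm, hA] at ht ⊢
  have hcont : Continuous fun t : ℝ => A + t ^ 2 := by fun_prop
  rcases lt_or_gt_of_ne ht with h | h
  · rw [if_pos h.le]
    refine HasDerivAt.congr_of_eventuallyEq hx.neg ?_
    filter_upwards [hcont.continuousAt.eventually (gt_mem_nhds h)] with u hu
    rw [max_eq_left hu.le, div_self hd.ne', one_mul]
    rfl
  · rw [if_neg (not_le.mpr h)]
    have hpos : A + t ^ 2 ≠ 0 := (hd.trans h).ne'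
    have e1 : HasDerivAt (fun t : ℝ => A + t ^ 2) (2 * t) t := by
      simpa using (hasDerivAt_pow 2 t).const_add A
    have e := ((((hasDerivAt_const t d).div e1 hpos)).mul hx).neg
    refine (e.congr_of_eventuallyEq ?_).congr_deriv ?_
    · filter_upwards [hcont.continuousAt.eventually (lt_mem_nhds h)] with u hu
      rw [max_eq_right (le_of_lt hu)]
      rfl
    · simp only [Pi.div_apply, radialFactor, Function.update_self]
      field_simp
      ring

/-- Stein's identity for the shrinkage term. -/
theorem integral_sub_mul_shrinkTerm [NeZero p] (θ : EuclideanSpace ℝ (Fin p)) {v d : ℝ}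
    (hv : 0 < v) (hd : 0 < d) (i j : Fin p) :
    ∫ x, (x j - θ j) * shrinkTerm d i x
        ∂((Measure.pi fun i => gaussianReal (θ i) v.toNNReal).map (WithLp.toLp 2)) =
      v * ∫ x, (if ‖x‖ ^ 2 ≤ d then -(if i = j then 1 else 0) else
        -(d * radialFactor (if i = j then 1 else 0) (‖x‖ ^ 2) (x i * x j)))
        ∂((Measure.pi fun i => gaussianReal (θ i) v.toNNReal).map (WithLp.toLp 2)) := by
  obtain ⟨k, rfl⟩ : ∃ k, p = k + 1 := Nat.exists_eq_succ_of_ne_zero (NeZero.ne p)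
  have hm : Measurable fun x : EuclideanSpace ℝ (Fin (k + 1)) =>
      (if ‖x‖ ^ 2 ≤ d then -(if i = j then (1 : ℝ) else 0) else
        -(d * radialFactor (if i = j then 1 else 0) (‖x‖ ^ 2) (x i * x j))) := by
    unfold radialFactor
    exact Measurable.ite (measurableSet_le (by fun_prop) measurable_const) (by fun_prop)
      (by fun_prop)
  have hc := continuous_shrinkTerm hd i
  rw [integral_map (by fun_prop) (by fun_prop), integral_map (by fun_prop) hm.aestronglyMeasurable]
  have key := integral_sub_mul_pi_gaussianReal (m := θ) (v := v.toNNReal) (B := d + 1) (B' := 3) j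
    (f := fun x => shrinkTerm d i (WithLp.toLp 2 x))
    (f' := fun x => (fun x : EuclideanSpace ℝ (Fin (k + 1)) =>
      (if ‖x‖ ^ 2 ≤ d then -(if i = j then (1 : ℝ) else 0) else
        -(d * radialFactor (if i = j then 1 else 0) (‖x‖ ^ 2) (x i * x j)))) (WithLp.toLp 2 x))
    (by fun_prop) (fun x => ⟨_, countable_setOf_const_add_sq_eq _ d, fun t ht =>
      hasDerivAt_shrinkTerm_update i j x t (by rw [norm_sq_toLp_update]; exact ht) hd⟩)
    (hm.comp (by fun_prop)) (fun x => abs_shrinkTerm_le_add hd i _) (fun x => ?_)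
  · rw [Real.coe_toNNReal _ hv.le] at key
    exact key
  -- The derivative is `derivKernel` with `c = d` and `s = 1`, so the bound 3 applies.
  · have := abs_derivKernel_le (c := d) (δ := if i = j then 1 else 0) (s := 1) hd
      (sq_nonneg ‖(WithLp.toLp 2 x : EuclideanSpace ℝ (Fin (k + 1)))‖)
      (by split_ifs <;> simp) (abs_coord_mul_le (WithLp.toLp 2 x) i j) one_pos
    simpa only [derivKernel, mul_one] using this

end Shrinkage


/-! ### Moments under the model and unbiasedness -/

section ModelMoments

variable {p n : ℕ}

theorem model_eq_prod (η : Param p) : model p n η =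
    (multivariateGaussian η.1 ((η.2 : ℝ) • (1 : Matrix (Fin p) (Fin p) ℝ))).prod
      (gammaMeasure ((n : ℝ) / 2) (1 / 2 / (η.2 : ℝ))) := by
  have hv : (0 : ℝ) < η.2 := η.2.2
  rw [model_eq, multivariateGaussian_smul_one _ hv.le]

theorem isProbabilityMeasure_scaledChiSquare (hn : 1 ≤ n) (η : Param p) :
    IsProbabilityMeasure (gammaMeasure ((n : ℝ) / 2) (1 / 2 / (η.2 : ℝ))) := by
  have hv : (0 : ℝ) < η.2 := η.2.2
  have hn' : (0 : ℝ) < n := by exact_mod_cast hn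
  exact isProbabilityMeasure_gammaMeasure (by positivity) (by positivity)

theorem ae_model_pos (η : Param p) : ∀ᵐ ω ∂(model p n η), 0 < ω.2 := by
  rw [model_eq_prod]
  exact Measure.quasiMeasurePreserving_snd.ae (ae_pos_gammaMeasure _ _)

theorem memLp_coord_model (hn : 1 ≤ n) (η : Param p) (i : Fin p) :
    MemLp (fun ω : Data p => ω.1 i) 2 (model p n η) := by
  have := isProbabilityMeasure_scaledChiSquare hn η
  rw [model_eq_prod]
  have h : MemLp (fun x : EuclideanSpace ℝ (Fin p) => x i) 2
      (multivariateGaussian η.1 ((η.2 : ℝ) • (1 : Matrix (Fin p) (Fin p) ℝ))) :=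
    (EuclideanSpace.proj (𝕜 := ℝ) i).comp_memLp' IsGaussian.memLp_two_id
  exact h.comp_measurePreserving measurePreserving_fst

theorem memLp_snd_model (hn : 1 ≤ n) (η : Param p) :
    MemLp (fun ω : Data p => ω.2) 2 (model p n η) := by
  have hv : (0 : ℝ) < η.2 := η.2.2
  have hn' : (0 : ℝ) < n := by exact_mod_cast hn
  have := isProbabilityMeasure_scaledChiSquare hn η
  rw [model_eq_prod]
  have h : MemLp (fun s : ℝ => s) 2 (gammaMeasure ((n : ℝ) / 2) (1 / 2 / (η.2 : ℝ))) :=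
    (memLp_two_iff_integrable_sq (by fun_prop)).mpr
      (integrable_pow_gammaMeasure (by positivity) (by positivity) 2)
  exact h.comp_measurePreserving measurePreserving_snd

theorem integral_snd_div_model (hn : 1 ≤ n) (η : Param p) :
    ∫ ω, ω.2 / n ∂(model p n η) = η.2 := by
  have := isProbabilityMeasure_scaledChiSquare hn η
  rw [model_eq_prod, integral_fun_snd (fun s : ℝ => s / n), integral_id_gammaMeasure hn η.2.2]
  simp

theorem integral_sub_mul_sub_model (hn : 1 ≤ n) (η : Param p) (i j : Fin p) :
    ∫ ω, (ω.1 i - η.1 i) * (ω.1 j - η.1 j) ∂(model p n η) =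
      if i = j then (η.2 : ℝ) else 0 := by
  have hv : (0 : ℝ) < η.2 := η.2.2
  have := isProbabilityMeasure_scaledChiSquare hn η
  have hS : ((η.2 : ℝ) • (1 : Matrix (Fin p) (Fin p) ℝ)).PosSemidef :=
    Matrix.PosSemidef.one.smul hv.le
  have hmean : ∀ l, ∫ x : EuclideanSpace ℝ (Fin p), x l
      ∂(multivariateGaussian η.1 ((η.2 : ℝ) • (1 : Matrix (Fin p) (Fin p) ℝ))) = η.1 l := fun l => by
    have := (EuclideanSpace.proj (𝕜 := ℝ) l).integral_comp_id_comm
      (IsGaussian.integrable_id (μ := multivariateGaussian η.1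
        ((η.2 : ℝ) • (1 : Matrix (Fin p) (Fin p) ℝ))))
    simp only [integral_id_multivariateGaussian] at this
    exact this
  have hcov := covariance_eval_multivariateGaussian (μ := η.1) hS i j
  rw [covariance, hmean, hmean] at hcov
  rw [model_eq_prod, integral_fun_fst
    (fun x : EuclideanSpace ℝ (Fin p) => (x i - η.1 i) * (x j - η.1 j)), hcov,
    probReal_univ, one_smul, Matrix.smul_apply, Matrix.one_apply, smul_eq_mul, mul_ite, mul_one,
    mul_zero]

theorem cut_pos (hp : 3 ≤ p) : 0 < cut p n := by
  have hp' : (3 : ℝ) ≤ p := by exact_mod_cast hp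
  exact div_pos (by linarith) (by positivity)

/-- The unbiased estimator of `E[(δ⁺ - X)ᵢ (X - θ)ⱼ]`. -/
def crossEstimator (n : ℕ) (c : ℝ) (i j : Fin p) (ω : Data p) : ℝ :=
  smoothedKernel n c (if i = j then 1 else 0) (‖ω.1‖ ^ 2) (ω.1 i * ω.1 j) ω.2

theorem measurable_crossEstimator (c : ℝ) (i j : Fin p) : Measurable (crossEstimator n c i j) := by
  unfold crossEstimator smoothedKernel radialFactor
  exact Measurable.ite (measurableSet_le (by fun_prop) (by fun_prop)) (by fun_prop) (by fun_prop)

theorem crossEstimator_comm (c : ℝ) (i j : Fin p) (ω : Data p) :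
    crossEstimator n c j i ω = crossEstimator n c i j ω := by
  unfold crossEstimator
  rw [mul_comm (ω.1 j)]
  simp only [eq_comm]

theorem abs_ite_one_zero_le (P : Prop) [Decidable P] : |(if P then 1 else 0 : ℝ)| ≤ 1 := by
  split_ifs <;> simp

theorem abs_crossEstimator_le (hn : 1 ≤ n) {c : ℝ} (hc : 0 < c) (i j : Fin p) {ω : Data p}
    (hω : 0 < ω.2) : |crossEstimator n c i j ω| ≤ 5 * ω.2 :=
  abs_smoothedKernel_le hn hc (sq_nonneg _) (abs_ite_one_zero_le _) (abs_coord_mul_le _ i j) hω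

/-- Every estimator involved is bounded by a multiple of `S`, which has a finite second moment. -/
theorem memLp_two_of_abs_le_snd (hn : 1 ≤ n) (η : Param p) {f : Data p → ℝ} (hf : Measurable f)
    {B : ℝ} (hB : ∀ ω : Data p, 0 < ω.2 → |f ω| ≤ B * ω.2) : MemLp f 2 (model p n η) := by
  refine ((memLp_snd_model hn η).const_mul B).mono hf.aestronglyMeasurable ?_
  filter_upwards [ae_model_pos η] with ω hω
  exact (hB ω hω).trans (le_abs_self _)

theorem measurable_shrinkTerm (c : ℝ) (i : Fin p) :
    Measurable fun ω : Data p => shrinkTerm (c * ω.2) i ω.1 := by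
  unfold shrinkTerm
  fun_prop

theorem memLp_shrinkTerm (hn : 1 ≤ n) {c : ℝ} (hc : 0 < c) (η : Param p) (i : Fin p) :
    MemLp (fun ω : Data p => shrinkTerm (c * ω.2) i ω.1) 2 (model p n η) := by
  refine (memLp_coord_model hn η i).mono (measurable_shrinkTerm c i).aestronglyMeasurable ?_
  filter_upwards [ae_model_pos η] with ω hω
  exact abs_shrinkTerm_le (mul_pos hc hω) i ω.1

theorem integral_sub_mul_shrinkTerm_model [NeZero p] (hn : 1 ≤ n) {c : ℝ} (hc : 0 < c)
    (η : Param p) (i j : Fin p) :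
    ∫ ω, (ω.1 j - η.1 j) * shrinkTerm (c * ω.2) i ω.1 ∂(model p n η) =
      ∫ ω, crossEstimator n c i j ω ∂(model p n η) := by
  have := isProbabilityMeasure_scaledChiSquare hn η
  have : NeZero n := ⟨by omega⟩
  have hv : (0 : ℝ) < η.2 := η.2.2
  set k : Data p → ℝ := fun ω =>
    derivKernel c (if i = j then 1 else 0) (‖ω.1‖ ^ 2) (ω.1 i * ω.1 j) ω.2 with hk
  have hkm : Measurable k := by
    rw [hk]
    unfold derivKernel radialFactor
    exact Measurable.ite (measurableSet_le (by fun_prop) (by fun_prop)) (by fun_prop) (by fun_prop)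
  have hki : Integrable k (model p n η) := by
    refine Integrable.of_bound hkm.aestronglyMeasurable 3 ?_
    filter_upwards [ae_model_pos η] with ω hω
    exact abs_derivKernel_le hc (sq_nonneg _) (abs_ite_one_zero_le _) (abs_coord_mul_le _ i j) hω
  have h1 : Integrable (fun ω : Data p => (ω.1 j - η.1 j) * shrinkTerm (c * ω.2) i ω.1)
      (model p n η) :=
    ((memLp_coord_model hn η j).sub (memLp_const _)).integrable_mul (memLp_shrinkTerm hn hc η i)
  have h2 : Integrable (crossEstimator n c i j) (model p n η) :=
    (memLp_two_of_abs_le_snd hn η (measurable_crossEstimator c i j)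
      fun ω hω => abs_crossEstimator_le hn hc i j hω).integrable one_le_two
  rw [model_eq_prod] at h1 h2 hki ⊢
  have e1 : ∀ᵐ s ∂(gammaMeasure ((n : ℝ) / 2) (1 / 2 / (η.2 : ℝ))),
      ∫ x, (x j - η.1 j) * shrinkTerm (c * s) i x
        ∂(multivariateGaussian η.1 ((η.2 : ℝ) • (1 : Matrix (Fin p) (Fin p) ℝ))) =
      η.2 * ∫ x, k (x, s)
        ∂(multivariateGaussian η.1 ((η.2 : ℝ) • (1 : Matrix (Fin p) (Fin p) ℝ))) := by
    filter_upwards [ae_pos_gammaMeasure _ _] with s hs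
    rw [multivariateGaussian_smul_one _ hv.le]
    exact integral_sub_mul_shrinkTerm η.1 hv (mul_pos hc hs) i j
  -- Stein's identity is used in `x` for fixed `s`; Fubini then reverses the order, and the factor
  -- `σ²` is absorbed in `s` for fixed `x`.
  rw [integral_prod_symm _ h1, integral_congr_ae e1, integral_const_mul,
    ← integral_prod_symm _ hki, integral_prod _ hki, integral_prod _ h2, ← integral_const_mul]
  refine integral_congr_ae (ae_of_all _ fun x => ?_)
  exact (integral_smoothedKernel hn hc (sq_nonneg _) (abs_ite_one_zero_le _)
    (abs_coord_mul_le x i j) hv).symm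

theorem positivePart_apply (hp : 3 ≤ p) {ω : Data p} (hω : 0 < ω.2) (i : Fin p) :
    positivePart p n ω i = ω.1 i + shrinkTerm (cut p n * ω.2) i ω.1 := by
  have hc : 0 < cut p n := cut_pos hp
  have hd : 0 < cut p n * ω.2 := mul_pos hc hω
  rw [positivePart, shrinkTerm, statW]
  simp only [PiLp.smul_apply, smul_eq_mul]
  -- At `x = 0`, `1 / statW` is 0 and the scalar factor is 1 rather than 0, which is harmless since
  -- it multiplies the zero vector.
  rcases eq_or_ne ω.1 0 with h | h
  · simp [h]
  have hr : 0 < ‖ω.1‖ ^ 2 := by positivity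
  have e : cut p n * (1 / (‖ω.1‖ ^ 2 / ω.2)) = cut p n * ω.2 / ‖ω.1‖ ^ 2 := by field_simp
  rw [e]
  rcases le_total (‖ω.1‖ ^ 2) (cut p n * ω.2) with h' | h'
  · rw [max_eq_left h', div_self hd.ne', max_eq_left]
    · ring
    · rw [sub_nonpos, le_div_iff₀ hr]
      linarith
  · rw [max_eq_right h', max_eq_right]
    · ring
    · rw [sub_nonneg, div_le_one hr]
      exact h'

/-- The unbiased estimator of an entry of the MSE matrix, before simplification. -/
def rawEntry (p n : ℕ) (i j : Fin p) (ω : Data p) : ℝ :=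
  (if i = j then 1 else 0) * (ω.2 / n) + 2 * crossEstimator n (cut p n) i j ω +
    shrinkTerm (cut p n * ω.2) i ω.1 * shrinkTerm (cut p n * ω.2) j ω.1

theorem measurable_rawEntry (i j : Fin p) : Measurable (rawEntry p n i j) := by
  have h1 := measurable_crossEstimator (n := n) (cut p n) i j
  have h2 := measurable_shrinkTerm (cut p n) i
  have h3 := measurable_shrinkTerm (cut p n) j
  unfold rawEntry
  fun_prop

theorem integrable_mse (hp : 3 ≤ p) (hn : 1 ≤ n) (η : Param p) (i j : Fin p) :
    Integrable (fun ω => (positivePart p n ω i - η.1 i) * (positivePart p n ω j - η.1 j))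
      (model p n η) := by
  have : NeZero n := ⟨by omega⟩
  have hc : 0 < cut p n := cut_pos hp
  have h : ∀ l, MemLp (fun ω : Data p => ω.1 l + shrinkTerm (cut p n * ω.2) l ω.1 - η.1 l) 2
      (model p n η) := fun l =>
    ((memLp_coord_model hn η l).add (memLp_shrinkTerm hn hc η l)).sub (memLp_const _)
  refine ((h i).integrable_mul (h j)).congr ?_
  filter_upwards [ae_model_pos η] with ω hω
  rw [positivePart_apply hp hω, positivePart_apply hp hω]
  rfl

theorem memLp_rawEntry (hp : 3 ≤ p) (hn : 1 ≤ n) (η : Param p) (i j : Fin p) :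
    MemLp (rawEntry p n i j) 2 (model p n η) := by
  have hc : 0 < cut p n := cut_pos hp
  have hn' : (1 : ℝ) ≤ n := by exact_mod_cast hn
  -- The constant is `1 + 2 · 5 + c`, one summand for each term of `rawEntry`.
  refine memLp_two_of_abs_le_snd hn η (measurable_rawEntry i j) (B := 11 + cut p n)
    fun ω hω => ?_
  have h1 : |(if i = j then 1 else 0) * (ω.2 / n)| ≤ ω.2 := by
    rw [abs_mul, abs_of_nonneg (by positivity : 0 ≤ ω.2 / n)]
    calc |(if i = j then 1 else 0 : ℝ)| * (ω.2 / n) ≤ 1 * (ω.2 / n) := by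
          gcongr
          exact abs_ite_one_zero_le _
      _ ≤ ω.2 := by rw [one_mul]; exact div_le_self hω.le hn'
  have h2 := abs_crossEstimator_le hn hc i j hω
  have h3 := abs_shrinkTerm_mul_le (mul_pos hc hω) i j ω.1
  unfold rawEntry
  refine (abs_add_three _ _ _).trans ?_
  rw [abs_mul 2, abs_two]
  linarith

theorem integral_rawEntry (hp : 3 ≤ p) (hn : 1 ≤ n) (η : Param p) (i j : Fin p) :
    ∫ ω, rawEntry p n i j ω ∂(model p n η) = mseMatrix n (positivePart p n) η i j := by
  have : NeZero n := ⟨by omega⟩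
  have : NeZero p := ⟨by omega⟩
  have hc : 0 < cut p n := cut_pos hp
  set g : Fin p → Data p → ℝ := fun l ω => shrinkTerm (cut p n * ω.2) l ω.1 with hg
  have hX : ∀ l, MemLp (fun ω : Data p => ω.1 l - η.1 l) 2 (model p n η) := fun l =>
    (memLp_coord_model hn η l).sub (memLp_const _)
  have hG : ∀ l, MemLp (g l) 2 (model p n η) := fun l => memLp_shrinkTerm hn hc η l
  have i1 : Integrable (fun ω : Data p => (ω.1 i - η.1 i) * (ω.1 j - η.1 j)) (model p n η) :=
    (hX i).integrable_mul (hX j)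
  have i2 : Integrable (fun ω : Data p => (ω.1 j - η.1 j) * g i ω) (model p n η) :=
    (hX j).integrable_mul (hG i)
  have i3 : Integrable (fun ω : Data p => (ω.1 i - η.1 i) * g j ω) (model p n η) :=
    (hX i).integrable_mul (hG j)
  have i4 : Integrable (fun ω : Data p => g i ω * g j ω) (model p n η) :=
    (hG i).integrable_mul (hG j)
  have i5 : Integrable (fun ω : Data p => (if i = j then 1 else 0) * (ω.2 / n)) (model p n η) :=
    (((memLp_snd_model hn η).integrable one_le_two).div_const _).const_mul _
  have i6 : Integrable (crossEstimator n (cut p n) i j) (model p n η) :=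
    (memLp_two_of_abs_le_snd hn η (measurable_crossEstimator _ i j)
      fun ω hω => abs_crossEstimator_le hn hc i j hω).integrable one_le_two
  have lhs : ∫ ω, rawEntry p n i j ω ∂(model p n η) =
      (if i = j then (η.2 : ℝ) else 0) + 2 * ∫ ω, crossEstimator n (cut p n) i j ω ∂(model p n η) +
        ∫ ω, g i ω * g j ω ∂(model p n η) := by
    have i56 : Integrable (fun ω : Data p => (if i = j then 1 else 0) * (ω.2 / n) +
        2 * crossEstimator n (cut p n) i j ω) (model p n η) := i5.add (i6.const_mul 2)
    unfold rawEntry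
    rw [integral_add i56 i4, integral_add i5 (i6.const_mul 2),
      integral_const_mul, integral_const_mul, integral_snd_div_model hn, ite_mul, one_mul,
      zero_mul]
  have rhs : mseMatrix n (positivePart p n) η i j =
      ∫ ω, ((ω.1 i - η.1 i) * (ω.1 j - η.1 j) + (ω.1 j - η.1 j) * g i ω +
        (ω.1 i - η.1 i) * g j ω + g i ω * g j ω) ∂(model p n η) := by
    refine integral_congr_ae ?_
    filter_upwards [ae_model_pos η] with ω hω
    rw [positivePart_apply hp hω, positivePart_apply hp hω]
    simp only [hg]
    ring
  have s1 := integral_sub_mul_shrinkTerm_model hn hc η i j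
  have s2 := integral_sub_mul_shrinkTerm_model hn hc η j i
  -- The two cross terms have the same estimator by symmetry, which explains the factor 2 in
  -- `rawEntry`.
  simp only [crossEstimator_comm] at s2
  have i12 : Integrable (fun ω : Data p => (ω.1 i - η.1 i) * (ω.1 j - η.1 j) +
      (ω.1 j - η.1 j) * g i ω) (model p n η) := i1.add i2
  have i123 : Integrable (fun ω : Data p => (ω.1 i - η.1 i) * (ω.1 j - η.1 j) +
      (ω.1 j - η.1 j) * g i ω + (ω.1 i - η.1 i) * g j ω) (model p n η) := i12.add i3
  rw [lhs, rhs, integral_add i123 i4, integral_add i12 i3,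
    integral_add i1 i2, integral_sub_mul_sub_model hn, s1, s2]
  ring

end ModelMoments

/-! ### Identification with the closed formulas -/

section Formulas

variable {p n : ℕ}

/-- An entry of the estimated MSE matrix of the positive-part Stein estimator, with
`Γᵀ E₁₁ Γ = x xᵀ / ‖x‖²`. -/
def mseEntry (p n : ℕ) (i j : Fin p) (ω : Data p) : ℝ :=
  if statW ω ≤ cut p n then
    ω.2 * ((1 / n - (2 / n - C₁ p n * statW ω ^ ((n : ℝ) / 2))) * (if i = j then 1 else 0) +
      (statW ω + C₂ p n * statW ω ^ ((n : ℝ) / 2)) * (ω.1 i * ω.1 j / ‖ω.1‖ ^ 2))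
  else
    ω.2 * (1 / n * (if i = j then 1 else 0) -
      (((p : ℝ) - 2) / ((n : ℝ) + 2) ^ 2 * (1 / statW ω)) *
        (2 * (if i = j then 1 else 0) - ((p : ℝ) + 2) * (ω.1 i * ω.1 j / ‖ω.1‖ ^ 2)))

theorem measurable_mseEntry (i j : Fin p) : Measurable (mseEntry p n i j) := by
  unfold mseEntry statW
  exact Measurable.ite (measurableSet_le (by fun_prop) (by fun_prop)) (by fun_prop) (by fun_prop)

theorem mseEntry_eq_rawEntry (hp : 3 ≤ p) (hn : 1 ≤ n) (i j : Fin p) {ω : Data p}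
    (hω : 0 < ω.2) : mseEntry p n i j ω = rawEntry p n i j ω := by
  have hc : 0 < cut p n := cut_pos hp
  have hn' : (0 : ℝ) < n := by exact_mod_cast hn
  have hd : 0 < cut p n * ω.2 := mul_pos hc hω
  have hiff : statW ω ≤ cut p n ↔ ‖ω.1‖ ^ 2 ≤ cut p n * ω.2 := by
    rw [statW, div_le_iff₀ hω]
  -- Since `r / (c s) = W / c`, its power splits off the factor `c^{-n/2}` of `C₁` and `C₂`.
  have hpow : (‖ω.1‖ ^ 2 / (cut p n * ω.2)) ^ ((n : ℝ) / 2) =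
      cut p n ^ (-(n : ℝ) / 2) * statW ω ^ ((n : ℝ) / 2) := by
    rw [mul_comm (cut p n), ← div_div, Real.div_rpow (by positivity) hc.le, neg_div,
      Real.rpow_neg hc.le, statW, div_eq_mul_inv, mul_comm]
  unfold mseEntry rawEntry crossEstimator smoothedKernel shrinkTerm
  simp only [hiff, hpow]
  generalize (if i = j then (1 : ℝ) else 0) = δ
  split_ifs with h
  · rw [max_eq_left h, div_self hd.ne', C₁, C₂]
    generalize cut p n ^ (-(n : ℝ) / 2) = z
    rcases eq_or_ne ω.1 0 with h0 | h0
    · have hW : statW ω ^ ((n : ℝ) / 2) = 0 := by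
        rw [statW, h0, norm_zero, zero_pow two_ne_zero, zero_div, Real.zero_rpow (by positivity)]
      rw [hW]
      simp only [h0, PiLp.zero_apply]
      ring
    · have hr : ‖ω.1‖ ≠ 0 := norm_ne_zero_iff.mpr h0
      generalize statW ω ^ ((n : ℝ) / 2) = w
      rw [statW, radialFactor]
      field_simp
      ring
  · have hr : ‖ω.1‖ ≠ 0 := by
      intro h0
      rw [h0] at h
      simp only [ne_eq, OfNat.ofNat_ne_zero, not_false_eq_true, zero_pow] at h
      exact h hd.le
    rw [max_eq_right (le_of_not_ge h), statW, radialFactor, cut]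
    field_simp
    ring

/-- The trace relation: the identity matrix has trace `p` and `E₁₁` has trace 1. -/
theorem C₀_eq : C₀ p n = p * C₁ p n + C₂ p n := by
  unfold C₀ C₁ C₂ cut
  have : (n : ℝ) + 2 ≠ 0 := by positivity
  ring

theorem msePositive_eq_sum (hp : 3 ≤ p) (hn : 1 ≤ n) (ω : Data p) :
    msePositive p n ω = ∑ i, mseEntry p n i i ω := by
  have hc : 0 < cut p n := cut_pos hp
  have hn' : (0 : ℝ) < n := by exact_mod_cast hn
  have hsum : ∑ i, ω.1 i * ω.1 i / ‖ω.1‖ ^ 2 = ‖ω.1‖ ^ 2 / ‖ω.1‖ ^ 2 := by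
    rw [← Finset.sum_div, EuclideanSpace.real_norm_sq_eq]
    simp only [sq]
  unfold msePositive mseEntry mseJS
  by_cases h : statW ω ≤ cut p n
  all_goals simp only [h, if_true, if_false]
  · rw [← Finset.mul_sum, Finset.sum_add_distrib, ← Finset.mul_sum, ← Finset.mul_sum, hsum]
    simp only [mul_one, Finset.sum_const, Finset.card_univ, Fintype.card_fin,
      nsmul_eq_mul]
    rw [C₀_eq]
    -- At `x = 0` the quotient `‖x‖² / ‖x‖²` is 0 instead of 1, but its coefficient `W + C₂ W^{n/2}`
    -- vanishes as well, because `n > 0`.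
    rcases eq_or_ne ω.1 0 with h0 | h0
    · have hW : statW ω = 0 := by rw [statW, h0]; simp
      rw [hW, Real.zero_rpow (by positivity)]
      ring
    · have hr : ‖ω.1‖ ^ 2 ≠ 0 := pow_ne_zero 2 (norm_ne_zero_iff.mpr h0)
      rw [div_self hr]
      ring
  · have hr : ‖ω.1‖ ^ 2 ≠ 0 := by
      intro h0
      rw [statW, h0, zero_div] at h
      exact h hc.le
    rw [← Finset.mul_sum, Finset.sum_sub_distrib, ← Finset.mul_sum, ← Finset.mul_sum,
      Finset.sum_sub_distrib, ← Finset.mul_sum, ← Finset.mul_sum, hsum, div_self hr]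
    simp only [mul_one, Finset.sum_const, Finset.card_univ, Fintype.card_fin,
      nsmul_eq_mul]
    rw [cut, div_pow]
    ring

/-- With `e` the first basis vector, `E₁₁ = e eᵀ`, and orthogonality gives `‖x‖ Gᵀ e = x`.
Multiplying by `‖x‖²` instead of dividing keeps the identity valid at `x = 0`. -/
theorem norm_sq_mul_transpose_mul_E₁₁_mul {G : Matrix (Fin p) (Fin p) ℝ}
    {x : EuclideanSpace ℝ (Fin p)} (h : IsAligning G x) (i j : Fin p) :
    ‖x‖ ^ 2 * (G.transpose * E₁₁ p * G) i j = x i * x j := by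
  set e : Fin p → ℝ := fun i => if i.val = 0 then 1 else 0 with he
  have hE : E₁₁ p = Matrix.vecMulVec e e := by
    ext i j
    simp only [E₁₁, Matrix.of_apply, Matrix.vecMulVec_apply, he]
    split_ifs <;> simp_all
  have hx : ‖x‖ • G.transpose.mulVec e = x.ofLp := by
    have h1 : ‖x‖ • e = G.mulVec x.ofLp := by
      rw [h.2]
      funext i
      simp [he]
    rw [← Matrix.mulVec_smul, h1, Matrix.mulVec_mulVec]
    have h2 : G.transpose * G = 1 := (Matrix.mem_orthogonalGroup_iff' (Fin p) ℝ).mp h.1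
    rw [h2, Matrix.one_mulVec]
  rw [hE, Matrix.mul_vecMulVec, Matrix.vecMulVec_mul, Matrix.vecMulVec_apply,
    ← Matrix.mulVec_transpose]
  have hi := congrFun hx i
  have hj := congrFun hx j
  simp only [Pi.smul_apply, smul_eq_mul] at hi hj
  rw [← hi, ← hj]
  ring

/-- The matrix formula depends on `Γ` only through `x xᵀ / ‖x‖²`, so every choice of `Γ`, measurable
or not, yields the same estimator. At `x = 0`, where `Γᵀ E₁₁ Γ` is not determined, its coefficient
is zero. -/
theorem mseMatrixPositive_apply (hp : 3 ≤ p) (hn : 1 ≤ n)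
    {Γ : EuclideanSpace ℝ (Fin p) → Matrix (Fin p) (Fin p) ℝ} (hΓ : ∀ x, IsAligning (Γ x) x)
    (i j : Fin p) (ω : Data p) : mseMatrixPositive p n Γ ω i j = mseEntry p n i j ω := by
  have hc : 0 < cut p n := cut_pos hp
  have hn' : (0 : ℝ) < n := by exact_mod_cast hn
  have hE := norm_sq_mul_transpose_mul_E₁₁_mul (hΓ ω.1) i j
  have hone : (Γ ω.1).transpose * Γ ω.1 = 1 :=
    (Matrix.mem_orthogonalGroup_iff' (Fin p) ℝ).mp (hΓ ω.1).1
  have hdiv : ‖ω.1‖ ^ 2 ≠ 0 →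
      ((Γ ω.1).transpose * E₁₁ p * Γ ω.1) i j = ω.1 i * ω.1 j / ‖ω.1‖ ^ 2 := fun hr => by
    rw [← hE, mul_div_cancel_left₀ _ hr]
  unfold mseMatrixPositive mseMatrixJS mseEntry
  by_cases h : statW ω ≤ cut p n
  all_goals simp only [h, if_true, if_false]
  · simp only [Matrix.mul_add, Matrix.mul_sub, Matrix.add_mul, Matrix.sub_mul, Matrix.mul_smul,
      Matrix.smul_mul, Matrix.mul_one, hone, Matrix.smul_apply, Matrix.add_apply,
      Matrix.sub_apply, Matrix.one_apply, smul_eq_mul]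
    rcases eq_or_ne ω.1 0 with h0 | h0
    · have hW : statW ω = 0 := by rw [statW, h0]; simp
      rw [hW, Real.zero_rpow (by positivity)]
      ring
    · rw [hdiv (pow_ne_zero 2 (norm_ne_zero_iff.mpr h0))]
      ring
  · have hr : ‖ω.1‖ ^ 2 ≠ 0 := by
      intro h0
      rw [statW, h0, zero_div] at h
      exact h hc.le
    simp only [Matrix.mul_sub, Matrix.sub_mul, Matrix.mul_smul,
      Matrix.smul_mul, Matrix.mul_one, hone, Matrix.smul_apply,
      Matrix.sub_apply, Matrix.one_apply, smul_eq_mul]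
    rw [hdiv hr]

theorem mseEntry_ae_eq_rawEntry (hp : 3 ≤ p) (hn : 1 ≤ n) (η : Param p) (i j : Fin p) :
    rawEntry p n i j =ᵐ[model p n η] mseEntry p n i j := by
  filter_upwards [ae_model_pos η] with ω hω
  exact (mseEntry_eq_rawEntry hp hn i j hω).symm

theorem memLp_mseEntry (hp : 3 ≤ p) (hn : 1 ≤ n) (η : Param p) (i j : Fin p) :
    MemLp (mseEntry p n i j) 2 (model p n η) :=
  (memLp_rawEntry hp hn η i j).ae_eq (mseEntry_ae_eq_rawEntry hp hn η i j)

theorem isUnbiased_mseEntry (hp : 3 ≤ p) (hn : 1 ≤ n) (i j : Fin p) :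
    IsUnbiased (model p n) (fun η => mseMatrix n (positivePart p n) η i j) (mseEntry p n i j) := by
  have : NeZero n := ⟨by omega⟩
  refine ⟨measurable_mseEntry i j, fun η =>
    ⟨(memLp_mseEntry hp hn η i j).integrable one_le_two, ?_⟩⟩
  exact (integral_congr_ae (mseEntry_ae_eq_rawEntry hp hn η i j)).symm.trans
    (integral_rawEntry hp hn η i j)

theorem isUnbiased_msePositive (hp : 3 ≤ p) (hn : 1 ≤ n) :
    IsUnbiased (model p n) (mse n (positivePart p n)) (msePositive p n) := by
  rw [funext (msePositive_eq_sum hp hn)]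
  have h := fun i => isUnbiased_mseEntry hp hn i i
  refine ⟨Finset.measurable_fun_sum _ fun i _ => (h i).1, fun η =>
    ⟨integrable_finsetSum _ fun i _ => ((h i).2 η).1, ?_⟩⟩
  rw [integral_finsetSum _ fun i _ => ((h i).2 η).1]
  exact Finset.sum_congr rfl fun i _ => ((h i).2 η).2

theorem isMatrixUnbiased_mseMatrixPositive (hp : 3 ≤ p) (hn : 1 ≤ n)
    {Γ : EuclideanSpace ℝ (Fin p) → Matrix (Fin p) (Fin p) ℝ} (hΓ : ∀ x, IsAligning (Γ x) x) :
    IsMatrixUnbiased (model p n) (mseMatrix n (positivePart p n)) (mseMatrixPositive p n Γ) := by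
  intro i j
  simp only [mseMatrixPositive_apply hp hn hΓ]
  exact isUnbiased_mseEntry hp hn i j

end Formulas

end SteinMSE

end

theorem mainTheorem10 (p n : ℕ) (hp : 3 ≤ p) (hn : 1 ≤ n) :
    -- the MSE matrix of the positive-part Stein estimator exists
    (∀ (η : SteinMSE.Param p) (i j : Fin p),
      Integrable (fun ω => (SteinMSE.positivePart p n ω i - η.1 i) *
        (SteinMSE.positivePart p n ω j - η.1 j)) (SteinMSE.model p n η)) ∧
    -- the UMVUE of the MSE
    (SteinMSE.IsUMVUE (SteinMSE.model p n) (SteinMSE.mse n (SteinMSE.positivePart p n))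
        (SteinMSE.msePositive p n) ∧
      ∀ T : SteinMSE.Data p → ℝ,
        SteinMSE.IsUMVUE (SteinMSE.model p n) (SteinMSE.mse n (SteinMSE.positivePart p n)) T →
        ∀ η, T =ᵐ[SteinMSE.model p n η] SteinMSE.msePositive p n) ∧
    -- the UMVUE of the MSE matrix
    (∀ Γ : EuclideanSpace ℝ (Fin p) → Matrix (Fin p) (Fin p) ℝ,
      (∀ x, SteinMSE.IsAligning (Γ x) x) →
      SteinMSE.IsMatrixUMVUE (SteinMSE.model p n)
        (SteinMSE.mseMatrix n (SteinMSE.positivePart p n))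
        (SteinMSE.mseMatrixPositive p n Γ) ∧
      ∀ T : SteinMSE.Data p → Matrix (Fin p) (Fin p) ℝ,
        SteinMSE.IsMatrixUMVUE (SteinMSE.model p n)
          (SteinMSE.mseMatrix n (SteinMSE.positivePart p n)) T →
        ∀ η, T =ᵐ[SteinMSE.model p n η] SteinMSE.mseMatrixPositive p n Γ) := by
  have hP := SteinMSE.isCompleteModel_model (p := p) hn
  refine ⟨SteinMSE.integrable_mse hp hn, ⟨hP.isUMVUE (SteinMSE.isUnbiased_msePositive hp hn)
    fun η => ?_, fun T hT => hP.ae_eq hT.1 (SteinMSE.isUnbiased_msePositive hp hn)⟩,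
    fun Γ hΓ => ⟨hP.isMatrixUMVUE (SteinMSE.isMatrixUnbiased_mseMatrixPositive hp hn hΓ)
      fun η i j => ?_, fun T hT =>
        hP.matrix_ae_eq hT.1 (SteinMSE.isMatrixUnbiased_mseMatrixPositive hp hn hΓ)⟩⟩
  · rw [funext (SteinMSE.msePositive_eq_sum hp hn)]
    exact memLp_finsetSum _ fun i _ => SteinMSE.memLp_mseEntry hp hn η i i
  · simp only [SteinMSE.mseMatrixPositive_apply hp hn hΓ]
    exact SteinMSE.memLp_mseEntry hp hn η i j
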